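/- Let $d$ be a positive square-free integer, let $K=\mathbb{Q}(\sqrt{-d})\subset\mathbb{C}$ with ring of integers $\mathbb{Z}_K$, and let $t\in\mathbb{Z}_K$ with $|t|\ge 100$. Put $$f_t(X)=X^4-tX^3-6X^2+tX+1 .$$ Then $f_t$ has exactly one complex root $\alpha$ with $|\alpha|\le 1/4$; put $\alpha^{(0)}=\alpha$ and $\alpha^{(3)}=-\dfrac{\alpha+1}{\alpha-1}$. The number $\alpha^{(3)}$ is also a root of $f_t$, and for $j\in\{0,3\}$ and all $p,q\in\mathbb{Z}_K$ with $|q|\ge 0.28\,|t|$ one has $$\left|\alpha^{(j)}-\frac{p}{q}\right|>\frac{1}{15.48\,|t|\,|q|^{\kappa+1}},\qquad\text{where}\qquad \kappa=\frac{\log|t|+1.08}{\log|t|-2.59}.$$ Moreover, $\kappa<2.83$. -/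

import Mathlib

open Polynomial NumberField

noncomputable section

namespace SimpleQuartic

/-- The imaginary quadratic field `ℚ(√(-d))`, as a subfield of `ℂ`, where `√(-d) = √d · i`. -/
abbrev ImagQuadField (d : ℕ) : IntermediateField ℚ ℂ :=
  IntermediateField.adjoin ℚ {((Real.sqrt (d : ℝ) : ℝ) : ℂ) * Complex.I}

/-- The complex number underlying an element of the ring of integers of `ℚ(√(-d))`. -/
abbrev toC {d : ℕ} (x : 𝓞 (ImagQuadField d)) : ℂ :=
  ((x : ImagQuadField d) : ℂ)

/-- The simplest quartic polynomial `f_t(X) = X⁴ - t X³ - 6 X² + t X + 1`. -/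
def quarticPoly (t : ℂ) : ℂ[X] :=
  X ^ 4 - C t * X ^ 3 - 6 * X ^ 2 + C t * X + 1

/-- The exponent `κ = (log |t| + 1.08) / (log |t| - 2.59)`. -/
def kappa (t : ℂ) : ℝ :=
  (Real.log ‖t‖ + 1.08) / (Real.log ‖t‖ - 2.59)

end SimpleQuartic

end

open Polynomial NumberField Filter Topology

/-! ### Discreteness of the integers of an imaginary quadratic field. -/

namespace SimpleQuartic

/-! Put s = 1/t and x = tan θ. The equation f_t(x) = 0 says tan 4θ = -4s, so the small root is α =
-tan(arctan(4s)/4), which solves the Riccati equation (1 + 16s²)α' = -(1 + α²) in s. Equivalently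
((1 + iα)/(1 - iα))⁴ = (1 - 4is)/(1 + 4is), so Padé approximants of a fourth root give
approximations -`num`/`den` of α, both terms obeying one three-term recurrence.

Analytic side: the Casoratian of the recurrence shows that |`den` α + `num`| is about |s|(16|s|²)^n,
while |`den`| grows like 4^n (`norm_den_mul_add_num_le`, `norm_den_le`). That the limit is a root of
f_t follows from the Riccati equation, satisfied up to a small defect, and Gronwall's inequality
(`scaledQuartic_limit`).

Arithmetic side: t^n `den` and t^n `num` are a common rational factor, at least (3/4)·1.32^n, times
integers of K (`factorial_mul_dvd`, `commonFactor_lower`). Dividing by it gives integers P_n, Q_n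
with |P_n| ≪ (3.033|t|)^n and |P_n α + Q_n| ≪ |t|⁻¹(12.14/|t|)^n.

Nonzero integers of K have absolute value at least 1 and consecutive pairs (P_n, Q_n) are
independent, so the usual argument (`lt_norm_sub_div`) yields the exponent
log(3.033|t|)/log(|t|/12.14), which is at most κ. The other root is (1 + α)/(1 - α), approximated by
(P_n - Q_n)/(P_n + Q_n). -/

theorem exists_rat_of_mem_imagQuadField {d : ℕ} {x : ℂ} (hx : x ∈ ImagQuadField d) :
    ∃ a b : ℚ, x = a + b * (((Real.sqrt (d : ℝ) : ℝ) : ℂ) * Complex.I) := by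
  have hsq : (((Real.sqrt (d : ℝ) : ℝ) : ℂ) * Complex.I) ^ 2 = -(d : ℂ) := by
    rw [mul_pow, Complex.I_sq, ← Complex.ofReal_pow, Real.sq_sqrt (Nat.cast_nonneg d)]
    push_cast; ring
  set θ : ℂ := ((Real.sqrt (d : ℝ) : ℝ) : ℂ) * Complex.I with hθ
  induction hx using IntermediateField.adjoin_induction with
  | mem x hx => exact ⟨0, 1, by simpa using hx⟩
  | algebraMap x => exact ⟨x, 0, by simp⟩
  | add x y _ _ hx hy =>
    obtain ⟨a, b, rfl⟩ := hx
    obtain ⟨a', b', rfl⟩ := hy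
    exact ⟨a + a', b + b', by push_cast; ring⟩
  | mul x y _ _ hx hy =>
    obtain ⟨a, b, rfl⟩ := hx
    obtain ⟨a', b', rfl⟩ := hy
    refine ⟨a * a' - d * b * b', a * b' + a' * b, ?_⟩
    push_cast
    linear_combination (b : ℂ) * b' * hsq
  | inv x _ hx =>
    obtain ⟨a, b, rfl⟩ := hx
    by_cases h0 : (a : ℂ) + b * θ = 0
    · exact ⟨0, 0, by simp [h0]⟩
    refine ⟨a / (a ^ 2 + d * b ^ 2), -b / (a ^ 2 + d * b ^ 2), ?_⟩
    have hn : ((a : ℂ) + b * θ) * (a - b * θ) = ((a ^ 2 + d * b ^ 2 : ℚ) : ℂ) := by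
      push_cast
      linear_combination -(b : ℂ) ^ 2 * hsq
    have hq : (a ^ 2 + d * b ^ 2 : ℚ) ≠ 0 := by
      intro h
      have h1 : a ^ 2 = 0 := by nlinarith [sq_nonneg a, mul_nonneg (Nat.cast_nonneg (α := ℚ) d) (sq_nonneg b)]
      have h2 : (d : ℚ) * b ^ 2 = 0 := by linarith
      have ha : a = 0 := by simpa using h1
      rcases mul_eq_zero.mp h2 with hd | hb
      · have : θ ^ 2 = 0 := by
          rw [hsq]; simpa using hd
        apply h0
        have : θ = 0 := by simpa using this
        simp [ha, this]
      · have : b = 0 := by simpa using hb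
        apply h0
        simp [ha, this]
    have hq' : ((a ^ 2 + d * b ^ 2 : ℚ) : ℂ) ≠ 0 := by exact_mod_cast hq
    have : ((a : ℂ) + b * θ)⁻¹ = (a - b * θ) / ((a ^ 2 + d * b ^ 2 : ℚ) : ℂ) := by
      rw [eq_div_iff hq', ← hn]; field_simp
    rw [this]
    push_cast
    ring

/-- A nonzero integer of an imaginary quadratic field has absolute value at least one. -/
theorem one_le_norm_toC {d : ℕ} (x : 𝓞 (ImagQuadField d)) (hx : toC x ≠ 0) : 1 ≤ ‖toC x‖ := by
  obtain ⟨a, b, hab⟩ := exists_rat_of_mem_imagQuadField (x : ImagQuadField d).2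
  have hint : IsIntegral ℤ (toC x) :=
    (RingOfIntegers.isIntegral_coe x).map (ImagQuadField d).val.toRingHom.toIntAlgHom
  have hconj : IsIntegral ℤ (starRingEnd ℂ (toC x)) :=
    hint.map (starRingEnd ℂ).toIntAlgHom
  -- The squared absolute value is both rational and an algebraic integer, hence a positive rational
  -- integer.
  have hmul : toC x * starRingEnd ℂ (toC x) = ((a ^ 2 + d * b ^ 2 : ℚ) : ℂ) := by
    change (((x : ImagQuadField d) : ℂ)) * starRingEnd ℂ (((x : ImagQuadField d) : ℂ)) = _
    rw [hab]
    have h1 : ((Real.sqrt (d : ℝ) : ℝ) : ℂ) ^ 2 = d := by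
      rw [← Complex.ofReal_pow, Real.sq_sqrt (Nat.cast_nonneg d)]; simp
    simp only [map_add, map_mul, Complex.conj_I, Complex.conj_ofReal, map_ratCast]
    push_cast
    linear_combination (b : ℂ) ^ 2 * h1 - (b : ℂ) ^ 2 * ((Real.sqrt (d : ℝ) : ℝ) : ℂ) ^ 2 * Complex.I_sq
  have hq : IsIntegral ℤ (((a ^ 2 + d * b ^ 2 : ℚ) : ℂ)) := hmul ▸ hint.mul hconj
  have hq' : IsIntegral ℤ (a ^ 2 + d * b ^ 2 : ℚ) := by
    have h : IsIntegral ℤ (algebraMap ℚ ℂ (a ^ 2 + d * b ^ 2)) := by simpa using hq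
    exact (isIntegral_algebraMap_iff (algebraMap ℚ ℂ).injective).mp h
  obtain ⟨m, hm⟩ := IsIntegrallyClosed.isIntegral_iff.mp hq'
  have hnorm : ‖toC x‖ ^ 2 = (m : ℝ) := by
    have h1 : ((‖toC x‖ ^ 2 : ℝ) : ℂ) = (m : ℂ) := by
      rw [Complex.ofReal_pow, ← Complex.mul_conj', hmul, ← hm]; simp
    exact_mod_cast h1
  have hpos : 0 < ‖toC x‖ := norm_pos_iff.mpr hx
  have hm1 : (1 : ℝ) ≤ m := by
    have : (0 : ℝ) < m := hnorm ▸ pow_pos hpos 2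
    have h0 : 0 < m := by exact_mod_cast this
    exact_mod_cast h0
  nlinarith
end SimpleQuartic

/-! ### Divisibility of the Padé coefficients, one prime power at a time. -/

namespace SimpleQuartic

/-- Since n = ⌊(4n+1)/4⌋ and ⌊n/3⌋ = ⌊(4n+1)/12⌋, every term depends only on z = ⌊(4n+1)/q⌋, and the
claim is a check of z modulo 12. The correction for z ≡ 3 (mod 4) is repaid by
`div_add_le_card_add_of_odd` and `div_add_two_mul_div_le`. -/
theorem div_three_add_div_twelve_le (n q : ℕ) :
    (4 * n + 1) / 3 / q + n / 3 / q ≤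
      n / q + (4 * n + 1) / 6 / q + (if (4 * n + 1) / q % 4 = 3 then 1 else 0) := by
  have h1 : (4 * n + 1) / 3 / q = (4 * n + 1) / q / 3 := by
    rw [Nat.div_div_eq_div_mul, Nat.div_div_eq_div_mul, mul_comm q]
  have h2 : (4 * n + 1) / 6 / q = (4 * n + 1) / q / 6 := by
    rw [Nat.div_div_eq_div_mul, Nat.div_div_eq_div_mul, mul_comm q]
  have h3 : n / 3 / q = (4 * n + 1) / q / 12 := by
    rw [show n / 3 = (4 * n + 1) / 12 by omega,
      Nat.div_div_eq_div_mul, Nat.div_div_eq_div_mul, mul_comm q]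
  have h4 : n / q = (4 * n + 1) / q / 4 := by
    conv_lhs => rw [show n = (4 * n + 1) / 4 by omega]
    rw [Nat.div_div_eq_div_mul, Nat.div_div_eq_div_mul, mul_comm q]
  rw [h1, h2, h3, h4]
  generalize (4 * n + 1) / q = z
  split_ifs <;> omega

theorem three_mul_le_of_div_mod_four {n q : ℕ} (hq : 0 < q) (h : (4 * n + 1) / q % 4 = 3) :
    3 * q ≤ 4 * (n % q) + 1 := by
  have hlt := Nat.mod_lt n hq
  have h1 : (4 * n + 1) / q = 4 * (n / q) + (4 * (n % q) + 1) / q := by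
    conv_lhs => rw [← Nat.div_add_mod n q]
    rw [show 4 * (q * (n / q) + n % q) + 1 = (4 * (n % q) + 1) + q * (4 * (n / q)) by ring,
      Nat.add_mul_div_left _ _ hq, add_comm]
  have h2 : (4 * (n % q) + 1) / q < 4 := by
    rw [Nat.div_lt_iff_lt_mul hq]; omega
  have h3 : 3 ≤ (4 * (n % q) + 1) / q := by
    rw [h1] at h
    generalize (4 * (n % q) + 1) / q = x at *
    omega
  exact (Nat.le_div_iff_mul_le hq).mp h3

theorem div_eq_ite_of_lt_two_mul {x q : ℕ} (_ : 0 < q) (hx : x < 2 * q) :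
    x / q = if q ≤ x then 1 else 0 := by
  split_ifs with h
  · apply Nat.div_eq_of_lt_le <;> omega
  · exact Nat.div_eq_of_lt (by omega)

/-- Here c inverts 4 modulo q, so the condition counted is m ≡ -c (mod q). -/
theorem add_div_le_card_add_div {q c l n : ℕ} (hc : q ∣ 4 * c - 1) (hc1 : 1 ≤ c) (hl : l ≤ n) :
    (n + c) / q ≤ ((Finset.Ioc l n).filter fun m => q ∣ 4 * m + 1).card + (l + c) / q := by
  induction n, hl using Nat.le_induction with
  | base => simp
  | succ n hn ih =>
    have hins : Finset.Ioc l (n + 1) = insert (n + 1) (Finset.Ioc l n) := by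
      ext x; simp only [Finset.mem_Ioc, Finset.mem_insert]; omega
    rw [hins, Finset.filter_insert, show n + 1 + c = n + c + 1 by ring, Nat.succ_div]
    by_cases h : q ∣ n + c + 1
    · have h' : q ∣ 4 * (n + 1) + 1 := by
        have := (Nat.dvd_sub (h.mul_left 4) hc)
        rwa [show 4 * (n + c + 1) - (4 * c - 1) = 4 * (n + 1) + 1 by omega] at this
      rw [if_pos h, if_pos h', Finset.card_insert_of_notMem (by simp)]
      omega
    · rw [if_neg h]
      split_ifs
      · rw [Finset.card_insert_of_notMem (by simp)]; omega
      · omega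

/-- Both bounds on c are needed in `div_add_le_card_add_of_odd`. -/
theorem exists_four_mul_sub_one {q : ℕ} (hq : Odd q) :
    ∃ c, 1 ≤ c ∧ q ∣ 4 * c - 1 ∧ 4 * c ≤ 3 * q + 1 ∧ q + 1 ≤ 4 * c := by
  obtain ⟨k, rfl⟩ := hq
  rcases Nat.even_or_odd' k with ⟨e, rfl | rfl⟩
  · exact ⟨3 * e + 1, by omega, ⟨3, by omega⟩, by omega, by omega⟩
  · exact ⟨e + 1, by omega, ⟨1, by omega⟩, by omega, by omega⟩

/-- Let ρ, λ be the residues of n, l and z = ⌊(4n+1)/q⌋. If λ ≤ ρ, removing quotients leaves [z ≡ 3]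
+ [λ+c ≥ q] ≤ [ρ+c ≥ q] + [ρ+λ ≥ q]. Now z ≡ 3 (mod 4) forces 4ρ ≥ 3q-1, so ρ+c ≥ q by the lower
bound on c; if also λ+c ≥ q, the upper bound on c gives ρ+λ ≥ q. If λ > ρ, a borrow in n-l leaves
one unit to spare. -/
theorem div_add_le_card_add_of_odd {q l n : ℕ} (hq : Odd q) (hl : l ≤ n) :
    l / q + (n - l) / q + n / q + (if (4 * n + 1) / q % 4 = 3 then 1 else 0) ≤
      ((Finset.Ioc l n).filter fun m => q ∣ 4 * m + 1).card + (n + l) / q := by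
  have hq0 := hq.pos
  obtain ⟨c, hc1, hc, hc3, hc4⟩ := exists_four_mul_sub_one hq
  have hcount := add_div_le_card_add_div hc hc1 hl
  have he := fun h => three_mul_le_of_div_mod_four (n := n) hq0 h
  generalize ((Finset.Ioc l n).filter fun m => q ∣ 4 * m + 1).card = N at *
  have hρ := Nat.mod_lt n hq0
  have hlam := Nat.mod_lt l hq0
  have hn := Nat.div_add_mod n q
  have hll := Nat.div_add_mod l q
  have hab : l / q ≤ n / q := Nat.div_le_div_right hl
  generalize hE : (4 * n + 1) / q % 4 = E at *
  generalize n / q = a at *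
  generalize l / q = b at *
  generalize n % q = ρ at *
  generalize l % q = lam at *
  subst hn hll
  have e1 : (q * a + ρ + c) / q = a + (ρ + c) / q := by
    rw [show q * a + ρ + c = ρ + c + q * a by ring, Nat.add_mul_div_left _ _ hq0, add_comm]
  have e2 : (q * b + lam + c) / q = b + (lam + c) / q := by
    rw [show q * b + lam + c = lam + c + q * b by ring, Nat.add_mul_div_left _ _ hq0, add_comm]
  have e3 : (q * a + ρ + (q * b + lam)) / q = a + b + (ρ + lam) / q := by
    rw [show q * a + ρ + (q * b + lam) = ρ + lam + q * (a + b) by ring,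
      Nat.add_mul_div_left _ _ hq0, add_comm]
  rw [e1, e2, div_eq_ite_of_lt_two_mul hq0 (show ρ + c < 2 * q by omega),
    div_eq_ite_of_lt_two_mul hq0 (show lam + c < 2 * q by omega)] at hcount
  rw [e3, div_eq_ite_of_lt_two_mul hq0 (show ρ + lam < 2 * q by omega)]
  obtain ⟨f, rfl⟩ := Nat.exists_eq_add_of_le hab
  by_cases hle : lam ≤ ρ
  · have e4 : (q * (b + f) + ρ - (q * b + lam)) / q = f := by
      rw [show q * (b + f) + ρ - (q * b + lam) = (ρ - lam) + q * f by
        rw [mul_add]; omega, Nat.add_mul_div_left _ _ hq0, Nat.div_eq_of_lt (by omega), zero_add]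
    rw [e4]
    split_ifs at * <;> grind
  · have hf : 1 ≤ f := by
      by_contra h
      have : f = 0 := by omega
      subst this
      simp at hl; omega
    have e4 : (q * (b + f) + ρ - (q * b + lam)) / q = f - 1 := by
      obtain ⟨g, rfl⟩ := Nat.exists_eq_add_of_le hf
      rw [show q * (b + (1 + g)) + ρ - (q * b + lam) = (q + ρ - lam) + q * g by
        rw [mul_add, mul_add]; omega, Nat.add_mul_div_left _ _ hq0, Nat.div_eq_of_lt (by omega)]
      omega
    rw [e4]
    split_ifs at * <;> grind

/-- The substitute at the prime 2, where the numbers 4m+1 contribute nothing. The form of the bound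
comes from v₂(2^k k!) = v₂((2k)!) with k = n-l. -/
theorem div_add_two_mul_div_le {q l n : ℕ} (hq0 : 0 < q) (hl : l ≤ n) :
    l / q + 2 * ((n - l) / q) + n / q + (if (4 * n + 1) / q % 4 = 3 then 1 else 0) ≤
      2 * (n - l) / q + (n + l) / q := by
  have he := fun h => three_mul_le_of_div_mod_four (n := n) hq0 h
  obtain ⟨j, rfl⟩ := Nat.exists_eq_add_of_le hl
  rw [Nat.add_sub_cancel_left]
  have hσ := Nat.mod_lt j hq0
  have hlam := Nat.mod_lt l hq0
  have hj := Nat.div_add_mod j q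
  have hll := Nat.div_add_mod l q
  generalize hE : (4 * (l + j) + 1) / q % 4 = E at *
  generalize j / q = a at *
  generalize l / q = b at *
  generalize j % q = σ at *
  generalize l % q = lam at *
  subst hj hll
  have e1 : 2 * (q * a + σ) / q = 2 * a + 2 * σ / q := by
    rw [show 2 * (q * a + σ) = 2 * σ + q * (2 * a) by ring, Nat.add_mul_div_left _ _ hq0, add_comm]
  have e2 : (q * b + lam + (q * a + σ)) / q = a + b + (lam + σ) / q := by
    rw [show q * b + lam + (q * a + σ) = lam + σ + q * (a + b) by ring,
      Nat.add_mul_div_left _ _ hq0, add_comm]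
  have e3 : (q * b + lam + (q * a + σ) + (q * b + lam)) / q = a + 2 * b + (2 * lam + σ) / q := by
    rw [show q * b + lam + (q * a + σ) + (q * b + lam) = 2 * lam + σ + q * (a + 2 * b) by ring,
      Nat.add_mul_div_left _ _ hq0, add_comm]
  have e4 : (q * b + lam + (q * a + σ)) % q = (lam + σ) % q := by
    rw [show q * b + lam + (q * a + σ) = lam + σ + q * (a + b) by ring, Nat.add_mul_mod_self_left]
  rw [e4] at he
  rw [e1, e2, e3]
  have hmod := Nat.div_add_mod (lam + σ) q
  rw [div_eq_ite_of_lt_two_mul hq0 (show lam + σ < 2 * q by omega)] at hmod ⊢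
  rw [div_eq_ite_of_lt_two_mul hq0 (show 2 * σ < 2 * q by omega)]
  have e5 : (if q ≤ 2 * lam + σ then 1 else 0) + (if 2 * q ≤ 2 * lam + σ then 1 else 0)
      ≤ (2 * lam + σ) / q := by
    split_ifs with h1 h2 h2
    · rw [Nat.le_div_iff_mul_le hq0]; omega
    · rw [Nat.le_div_iff_mul_le hq0]; omega
    · exact absurd h2 (by omega)
    · exact Nat.zero_le _
  generalize (2 * lam + σ) / q = Y at *
  generalize (lam + σ) % q = ρ at *
  by_cases hs : q ≤ lam + σ
  · rw [if_pos hs] at hmod ⊢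
    split_ifs at * <;> omega
  · rw [if_neg hs] at hmod ⊢
    split_ifs at * <;> omega

open Nat in
-- Legendre's formula reduces the claim, prime by prime, to the floor inequalities above, summed
-- over the powers of the prime.
theorem factorial_mul_dvd {n l : ℕ} (hl : l ≤ n) :
    ((4 * n + 1) / 3)! * (n / 3)! * (l ! * (n - l)!) ∣
      ((4 * n + 1) / 6)! * (2 ^ (n - l) * (∏ m ∈ Finset.Ioc l n, (4 * m + 1)) * (n + l)!) := by
  have hprod : (∏ m ∈ Finset.Ioc l n, (4 * m + 1)) ≠ 0 :=
    Finset.prod_ne_zero_iff.mpr fun m _ => by omega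
  have hf := fun k => Nat.factorial_ne_zero k
  have hN0 : ((4 * n + 1) / 6)! * (2 ^ (n - l) * (∏ m ∈ Finset.Ioc l n, (4 * m + 1)) * (n + l)!) ≠ 0 := by
    have := hf
    positivity
  rw [← Nat.factorization_prime_le_iff_dvd (by have := hf; positivity) hN0]
  intro p hp
  -- A common cutoff beyond every relevant exponent, so that all Legendre sums have the same range.
  set b := 4 * n + 2 with hb
  have hpb : ∀ k, k ≤ 4 * n + 1 → k < p ^ b := fun k hk =>
    lt_of_lt_of_le (lt_of_le_of_lt hk (by omega : 4 * n + 1 < b)) (Nat.lt_pow_self hp.one_lt).le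
  have hlog : ∀ k, k ≤ 4 * n + 1 → Nat.log p k < b := fun k hk =>
    lt_of_le_of_lt (Nat.log_le_self p k) (by omega)
  have hfac : ∀ k, k ≤ 4 * n + 1 → (k !).factorization p = ∑ i ∈ Finset.Ico 1 b, k / p ^ i :=
    fun k hk => Nat.factorization_factorial hp (hlog k hk)
  have key : ∀ x y : ℕ, x ≠ 0 → y ≠ 0 →
      (x * y).factorization p = x.factorization p + y.factorization p := fun x y hx hy => by
    rw [Nat.factorization_mul hx hy]; rfl
  rw [key _ _ (by have := hf; positivity) (by have := hf; positivity), key _ _ (hf _) (hf _),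
    key _ _ (hf _) (hf _), key _ _ (hf _) (by have := hf; positivity),
    key _ _ (by positivity) (hf _), key _ _ (by positivity) hprod,
    hfac _ (by omega), hfac _ (by omega), hfac _ (by omega), hfac _ (by omega),
    hfac _ (by omega), hfac _ (by omega)]
  rcases hp.eq_two_or_odd' with rfl | hodd
  · have h2 : (2 ^ (n - l)).factorization 2 + ∑ i ∈ Finset.Ico 1 b, (n - l) / 2 ^ i =
        ∑ i ∈ Finset.Ico 1 b, 2 * (n - l) / 2 ^ i := by
      rw [← hfac _ (by omega), ← hfac _ (by omega), Nat.factorization_factorial_mul Nat.prime_two,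
        Nat.prime_two.factorization_pow]
      simp [add_comm]
    have hsum : ∑ i ∈ Finset.Ico 1 b, ((4 * n + 1) / 3 / 2 ^ i + n / 3 / 2 ^ i + l / 2 ^ i
          + 2 * ((n - l) / 2 ^ i)) ≤
        ∑ i ∈ Finset.Ico 1 b, ((4 * n + 1) / 6 / 2 ^ i + 2 * (n - l) / 2 ^ i + (n + l) / 2 ^ i) := by
      refine Finset.sum_le_sum fun i _ => ?_
      have h1 := div_three_add_div_twelve_le n (2 ^ i)
      have h2 := div_add_two_mul_div_le (q := 2 ^ i) (by positivity) hl
      omega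
    simp only [Finset.sum_add_distrib, ← Finset.mul_sum] at hsum
    omega
  · have hcard : (∏ m ∈ Finset.Ioc l n, (4 * m + 1)).factorization p =
        ∑ i ∈ Finset.Ico 1 b, ((Finset.Ioc l n).filter fun m => p ^ i ∣ 4 * m + 1).card := by
      rw [Nat.factorization_prod_apply (fun m _ => by omega)]
      simp_rw [Finset.card_filter]
      rw [Finset.sum_comm]
      refine Finset.sum_congr rfl fun m hm => ?_
      rw [Nat.factorization_eq_card_pow_dvd_of_lt hp (by omega)
        (hpb _ (by have := (Finset.mem_Ioc.mp hm).2; omega)), Finset.card_filter]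
    have hsum : ∑ i ∈ Finset.Ico 1 b, ((4 * n + 1) / 3 / p ^ i + n / 3 / p ^ i + l / p ^ i
          + (n - l) / p ^ i) ≤
        ∑ i ∈ Finset.Ico 1 b, ((4 * n + 1) / 6 / p ^ i +
          ((Finset.Ioc l n).filter fun m => p ^ i ∣ 4 * m + 1).card + (n + l) / p ^ i) := by
      refine Finset.sum_le_sum fun i _ => ?_
      have h1 := div_three_add_div_twelve_le n (p ^ i)
      have h2 := div_add_le_card_add_of_odd (q := p ^ i) hodd.pow hl
      omega
    simp only [Finset.sum_add_distrib] at hsum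
    rw [hcard]
    omega

end SimpleQuartic

/-! ### Size of the common factor. -/

namespace SimpleQuartic

open Nat in
/-- The ratio `⌊(4n+1)/3⌋! ⌊n/3⌋! / (n! ⌊(4n+1)/6⌋!)`, a common factor of the coefficients of
`padePoly n`. -/
noncomputable def commonFactor (n : ℕ) : ℚ :=
  (((4 * n + 1) / 3)! * (n / 3)! : ℕ) / (n ! * ((4 * n + 1) / 6)! : ℕ)

theorem commonFactor_pos (n : ℕ) : 0 < commonFactor n := by
  unfold commonFactor
  have := fun k => Nat.factorial_pos k
  positivity

open Nat in
-- The quotient of consecutive ratios increases to 64/27. It equals 7/3 at the step from m = 1 to 2,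
-- and the constant 6/7 absorbs the first step, where it is only 2.
theorem factorial_ratio_lower (m : ℕ) :
    (6 / 7 : ℚ) * (7 / 3) ^ m * ((3 * m)! * (2 * m)!) ≤ (4 * m)! * m ! := by
  rcases Nat.eq_zero_or_pos m with rfl | hm
  · norm_num
  induction m, hm using Nat.le_induction with
  | base => norm_num [Nat.factorial]
  | succ m hm ih =>
    have e1 : (3 * (m + 1))! = (3 * m + 3) * (3 * m + 2) * (3 * m + 1) * (3 * m)! := by
      rw [show 3 * (m + 1) = 3 * m + 1 + 1 + 1 by ring]
      simp only [Nat.factorial_succ]; ring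
    have e2 : (2 * (m + 1))! = (2 * m + 2) * (2 * m + 1) * (2 * m)! := by
      rw [show 2 * (m + 1) = 2 * m + 1 + 1 by ring]
      simp only [Nat.factorial_succ]; ring
    have e3 : (4 * (m + 1))! =
        (4 * m + 4) * (4 * m + 3) * (4 * m + 2) * (4 * m + 1) * (4 * m)! := by
      rw [show 4 * (m + 1) = 4 * m + 1 + 1 + 1 + 1 by ring]
      simp only [Nat.factorial_succ]; ring
    rw [e1, e2, e3, Nat.factorial_succ]
    push_cast
    have hm' : (1 : ℚ) ≤ m := by exact_mod_cast hm
    have hpoly : (7 / 3 : ℚ) * ((3 * m + 3) * (3 * m + 2) * (3 * m + 1) * ((2 * m + 2) * (2 * m + 1)))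
        ≤ (4 * m + 4) * (4 * m + 3) * (4 * m + 2) * (4 * m + 1) * (m + 1) := by
      have h1 : (7 : ℚ) * ((3 * m + 2) * (3 * m + 1)) ≤ 4 * ((4 * m + 3) * (4 * m + 1)) := by
        nlinarith
      have h2 : (0 : ℚ) ≤ (m + 1) * (2 * m + 2) * (2 * m + 1) := by positivity
      nlinarith [mul_le_mul_of_nonneg_left h1 h2]
    calc _ = (6 / 7 : ℚ) * (7 / 3) ^ m * ((3 * m)! * (2 * m)!) *
          ((7 / 3 : ℚ) * ((3 * m + 3) * (3 * m + 2) * (3 * m + 1) * ((2 * m + 2) * (2 * m + 1)))) := by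
          ring
      _ ≤ ((4 * m)! * m ! : ℚ) *
          ((4 * m + 4) * (4 * m + 3) * (4 * m + 2) * (4 * m + 1) * (m + 1)) := by
          gcongr
      _ = _ := by ring

open Nat in
-- The true growth rate is (64/27)^(1/3) = 4/3; the value 1.32 is usable because 1.32³ < 7/3. The
-- tight case for the constant 3/4 is n = 1, where the factor equals 1.
theorem commonFactor_lower (n : ℕ) : (3 / 4 : ℚ) * (1.32) ^ n ≤ commonFactor n := by
  unfold commonFactor
  have hf := fun k => Nat.factorial_pos k
  rw [le_div_iff₀ (by have := hf; positivity)]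
  set m := n / 3 with hm
  have hS := factorial_ratio_lower m
  have hpow : (1.32 ^ 3 : ℚ) ^ m ≤ (7 / 3) ^ m := by
    apply pow_le_pow_left₀ <;> norm_num
  have h0 : (0 : ℚ) < (3 * m)! * (2 * m)! := by have := hf; positivity
  have hp : (0 : ℚ) ≤ (7 / 3) ^ m := by positivity
  have hm0 : (0 : ℚ) ≤ m := by positivity
  have hS' : (6 / 7 : ℚ) * (1.32 ^ 3) ^ m * ((3 * m)! * (2 * m)!) ≤ (4 * m)! * m ! := by
    refine le_trans ?_ hS
    gcongr
  have hq : (0 : ℚ) ≤ (1.32 ^ 3) ^ m := by positivity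
  have hn : n = 3 * m ∨ n = 3 * m + 1 ∨ n = 3 * m + 2 := by omega
  rcases hn with h | h | h
  · rw [h, show (4 * (3 * m) + 1) / 3 = 4 * m by omega, show (4 * (3 * m) + 1) / 6 = 2 * m by omega,
      pow_mul]
    push_cast
    refine le_trans ?_ hS'
    have := mul_nonneg hq h0.le
    linarith
  -- At m = 0 the loss 6/7 is too large for the general estimate, so n = 1 is computed directly.
  · rcases Nat.eq_zero_or_pos m with h1 | h1
    · rw [h, h1]; norm_num [Nat.factorial]
    rw [h, show (4 * (3 * m + 1) + 1) / 3 = 4 * m + 1 by omega,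
      show (4 * (3 * m + 1) + 1) / 6 = 2 * m by omega,
      pow_succ, pow_mul, Nat.factorial_succ, Nat.factorial_succ]
    push_cast
    have h2 : (1 : ℚ) ≤ m := by exact_mod_cast h1
    have h3 : (3 / 4 : ℚ) * 1.32 * (3 * m + 1) ≤ 6 / 7 * (4 * m + 1) := by norm_num; linarith
    have h4 := mul_le_mul_of_nonneg_right h3 (mul_nonneg hq h0.le)
    have h5 := mul_le_mul_of_nonneg_right hS' (by positivity : (0 : ℚ) ≤ 4 * m + 1)
    linarith
  · rw [h, show (4 * (3 * m + 2) + 1) / 3 = 4 * m + 1 + 1 + 1 by omega,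
      show (4 * (3 * m + 2) + 1) / 6 = 2 * m + 1 by omega,
      pow_add, pow_mul, Nat.factorial_succ, Nat.factorial_succ, Nat.factorial_succ,
      Nat.factorial_succ, Nat.factorial_succ, Nat.factorial_succ]
    push_cast
    have h3 : (3 / 4 : ℚ) * 1.32 ^ 2 * ((3 * m + 2) * (3 * m + 1) * (2 * m + 1)) ≤
        6 / 7 * ((4 * m + 3) * (4 * m + 2) * (4 * m + 1)) := by
      have : (0 : ℚ) ≤ m * (m * m) := by positivity
      nlinarith [mul_nonneg hm0 hm0]
    have h4 := mul_le_mul_of_nonneg_right h3 (mul_nonneg hq h0.le)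
    have h5 := mul_le_mul_of_nonneg_right hS'
      (by positivity : (0 : ℚ) ≤ (4 * m + 3) * (4 * m + 2) * (4 * m + 1))
    linarith

/-! ### Padé coefficients: recurrence and divisibility. -/

noncomputable def coeffAux (l d : ℕ) : ℚ :=
  2 ^ d * (∏ i ∈ Finset.range d, (4 * ((l : ℚ) + 1 + i) + 1)) * (2 * l + d).factorial /
    ((l + d).factorial * l.factorial * d.factorial)

theorem coeffAux_succ (l d : ℕ) : coeffAux l (d + 1) =
    coeffAux l d * (2 * (4 * (l + d) + 5) * (2 * l + d + 1) / ((l + d + 1) * (d + 1))) := by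
  unfold coeffAux
  rw [Finset.prod_range_succ, ← add_assoc, ← add_assoc, Nat.factorial_succ, Nat.factorial_succ,
    Nat.factorial_succ, pow_succ]
  have := fun k => Nat.factorial_ne_zero k
  push_cast
  field_simp
  ring

theorem coeffAux_add_two (l d : ℕ) : coeffAux l (d + 2) =
    coeffAux (l + 1) d * (4 * (4 * l + 5) * (4 * (l + d) + 9) * (l + 1) /
      ((l + d + 2) * (d + 1) * (d + 2))) := by
  unfold coeffAux
  rw [Finset.prod_range_succ', Finset.prod_range_succ, show 2 * (l + 1) + d = 2 * l + (d + 2) by ring,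
    show l + (d + 2) = l + 1 + d + 1 by ring, Nat.factorial_succ (l + 1 + d), Nat.factorial_succ l,
    Nat.factorial_succ (d + 1), Nat.factorial_succ d]
  have := fun k => Nat.factorial_ne_zero k
  have hp : ∀ k : ℕ, 4 * ((l : ℚ) + 1 + (k + 1 : ℕ)) + 1 = 4 * ((l + 1 : ℕ) + 1 + (k : ℚ)) + 1 := by
    intro k; push_cast; ring
  simp only [hp]
  push_cast
  field_simp
  ring

theorem coeffAux_succ_zero (l : ℕ) : coeffAux (l + 1) 0 =
    coeffAux l 0 * (2 * (2 * l + 1) / (l + 1)) := by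
  unfold coeffAux
  rw [show 2 * (l + 1) + 0 = 2 * l + 1 + 1 by ring, Nat.factorial_succ, Nat.factorial_succ,
    show l + 1 + 0 = l + 1 by ring, Nat.factorial_succ]
  have := fun k => Nat.factorial_ne_zero k
  simp only [Finset.range_zero, Finset.prod_empty, add_zero]
  push_cast
  field_simp
  ring

/-- `coeffAux` takes d = n - l as an independent variable, which keeps the contiguity relations free
of truncated subtraction. -/
noncomputable def padeCoeff (n l : ℕ) : ℚ := if l ≤ n then coeffAux l (n - l) else 0

theorem padeCoeff_add (l d : ℕ) : padeCoeff (l + d) l = coeffAux l d := by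
  simp [padeCoeff]

theorem padeCoeff_of_lt {n l : ℕ} (h : n < l) : padeCoeff n l = 0 := by
  simp [padeCoeff, not_le.mpr h]

theorem padeCoeff_recurrence_zero (n : ℕ) :
    ((n : ℚ) + 1) * (n + 2) * padeCoeff (n + 2) 0 =
      (2 * n + 3) * (n + 1) * (8 * padeCoeff (n + 1) 0) -
        4 * (4 * n + 3) * (4 * n + 5) * padeCoeff n 0 := by
  simp only [padeCoeff, Nat.zero_le, if_true, Nat.sub_zero]
  rw [coeffAux_succ 0 (n + 1), coeffAux_succ 0 n]
  push_cast
  field_simp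
  ring

theorem padeCoeff_recurrence_succ (n l : ℕ) :
    ((n : ℚ) + 1) * (n + 2) * padeCoeff (n + 2) (l + 1) =
      (2 * n + 3) * (n + 1) * (2 * padeCoeff (n + 1) l + 8 * padeCoeff (n + 1) (l + 1)) -
        4 * (4 * n + 3) * (4 * n + 5) * padeCoeff n (l + 1) := by
  rcases lt_or_ge n (l + 1) with h | h
  · rw [padeCoeff_of_lt h]
    rcases Nat.lt_or_ge (n + 1) (l + 1) with h1 | h1
    · rw [padeCoeff_of_lt h1]
      rcases Nat.lt_or_ge (n + 1) l with h2 | h2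
      · rw [padeCoeff_of_lt h2, padeCoeff_of_lt (by omega : n + 2 < l + 1)]; ring
      · obtain rfl : l = n + 1 := by omega
        rw [show n + 2 = n + 1 + 1 + 0 by ring, padeCoeff_add (n + 1 + 1) 0,
          show padeCoeff (n + 1) (n + 1) = _ from padeCoeff_add (n + 1) 0, coeffAux_succ_zero]
        push_cast
        field_simp
        ring
    · obtain rfl : l = n := by omega
      rw [show l + 2 = l + 1 + 1 by ring, padeCoeff_add (l + 1) 1, padeCoeff_add l 1,
          show padeCoeff (l + 1) (l + 1) = _ from padeCoeff_add (l + 1) 0, coeffAux_succ (l + 1) 0,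
          coeffAux_succ l 0, coeffAux_succ_zero]
      push_cast
      field_simp
      ring
  · obtain ⟨d, rfl⟩ := Nat.exists_eq_add_of_le h
    rw [show l + 1 + d + 2 = l + 1 + (d + 2) by ring, padeCoeff_add (l + 1) (d + 2),
      show padeCoeff (l + 1 + d + 1) l = padeCoeff (l + (d + 2)) l by congr 1; ring,
      padeCoeff_add l (d + 2),
      show l + 1 + d + 1 = l + 1 + (d + 1) by ring, padeCoeff_add (l + 1) (d + 1),
      padeCoeff_add (l + 1) d, show coeffAux (l + 1) (d + 2) = _ from coeffAux_succ (l + 1) (d + 1),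
      coeffAux_add_two l d, coeffAux_succ (l + 1) d]
    push_cast
    field_simp
    ring

/-- The homogeneous Padé (Jacobi) polynomial of `((1 + x) / (1 - x)) ^ (1 / 4)` in a shifted
variable. -/
noncomputable def padePoly (n : ℕ) : ℚ[X] :=
  ∑ l ∈ Finset.range (n + 1), C (padeCoeff n l) * X ^ l

theorem coeff_padePoly (n l : ℕ) : (padePoly n).coeff l = padeCoeff n l := by
  simp only [padePoly, finsetSum_coeff, coeff_C_mul_X_pow, Finset.sum_ite_eq, Finset.mem_range]
  split_ifs with h
  · rfl
  · rw [padeCoeff_of_lt (by omega)]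

/-- The Jacobi recurrence, with middle factor 2X + 8. At X = -εt - 4 this factor becomes -2εt, which
matches `recSeq` at s = 1/t when ε² = -1. -/
theorem padePoly_recurrence (n : ℕ) :
    C (((n : ℚ) + 1) * (n + 2)) * padePoly (n + 2) =
      C ((2 * (n : ℚ) + 3) * (n + 1)) * (C 2 * (X * padePoly (n + 1)) + C 8 * padePoly (n + 1)) -
        C (4 * (4 * (n : ℚ) + 3) * (4 * n + 5)) * padePoly n := by
  ext l
  cases l with
  | zero =>
    simp only [coeff_sub, coeff_add, coeff_C_mul, coeff_X_mul_zero, coeff_padePoly]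
    rw [padeCoeff_recurrence_zero]; ring
  | succ l =>
    simp only [coeff_sub, coeff_add, coeff_C_mul, coeff_X_mul, coeff_padePoly]
    rw [padeCoeff_recurrence_succ]

theorem exists_int_padeCoeff (n l : ℕ) : ∃ e : ℤ, padeCoeff n l = commonFactor n * e := by
  rcases Nat.lt_or_ge n l with h | h
  · exact ⟨0, by simp [padeCoeff_of_lt h]⟩
  obtain ⟨e, he⟩ := factorial_mul_dvd h
  refine ⟨e, ?_⟩
  obtain ⟨d, rfl⟩ := Nat.exists_eq_add_of_le h
  rw [padeCoeff_add, coeffAux, commonFactor]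
  have hprod : ((∏ m ∈ Finset.Ioc l (l + d), (4 * m + 1) : ℕ) : ℚ) =
      ∏ i ∈ Finset.range d, (4 * ((l : ℚ) + 1 + i) + 1) := by
    rw [← Finset.Ico_add_one_add_one_eq_Ioc, Finset.prod_Ico_eq_prod_range]
    push_cast
    rw [show l + d - l = d by omega]
  have he' := congrArg (fun x : ℕ => (x : ℚ)) he
  simp only [Nat.add_sub_cancel_left] at he'
  push_cast at he' hprod
  rw [hprod, show l + d + l = 2 * l + d by ring] at he'
  have := fun k => Nat.factorial_ne_zero k
  push_cast
  field_simp
  linear_combination he'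

end SimpleQuartic

/-! ### Growth and convergence of the approximants. -/

namespace SimpleQuartic

/-- Solutions of the three-term recurrence satisfied by the numerators and denominators of the
Padé approximants, in the variable `s = 1 / t`. -/
noncomputable def recSeq (x₀ x₁ s : ℂ) : ℕ → ℂ
  | 0 => x₀
  | 1 => x₁
  | n + 2 => 2 * (2 * n + 3) / (n + 2) * recSeq x₀ x₁ s (n + 1) +
      4 * (4 * n + 3) * (4 * n + 5) / ((n + 1) * (n + 2)) * s ^ 2 * recSeq x₀ x₁ s n

noncomputable def den (s : ℂ) : ℕ → ℂ := recSeq 1 2 s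

noncomputable def num (s : ℂ) : ℕ → ℂ := recSeq 0 (2 * s) s

theorem den_zero (s : ℂ) : den s 0 = 1 := rfl
theorem den_one (s : ℂ) : den s 1 = 2 := rfl
theorem num_zero (s : ℂ) : num s 0 = 0 := rfl
theorem num_one (s : ℂ) : num s 1 = 2 * s := rfl

theorem den_add_two (s : ℂ) (n : ℕ) : den s (n + 2) =
    2 * (2 * n + 3) / (n + 2) * den s (n + 1) +
      4 * (4 * n + 3) * (4 * n + 5) / ((n + 1) * (n + 2)) * s ^ 2 * den s n := rfl

theorem num_add_two (s : ℂ) (n : ℕ) : num s (n + 2) =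
    2 * (2 * n + 3) / (n + 2) * num s (n + 1) +
      4 * (4 * n + 3) * (4 * n + 5) / ((n + 1) * (n + 2)) * s ^ 2 * num s n := rfl

theorem norm_sq_le {s : ℂ} (hs : ‖s‖ ≤ 1 / 100) : ‖s‖ ^ 2 ≤ 1 / 10000 := by
  nlinarith [norm_nonneg s]

theorem norm_recA (n : ℕ) : ‖(2 * (2 * n + 3) / (n + 2) : ℂ)‖ = 2 * (2 * n + 3) / (n + 2) := by
  have : (2 * (2 * n + 3) / (n + 2) : ℂ) = ((2 * (2 * n + 3) / (n + 2) : ℝ) : ℂ) := by push_cast; rfl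
  rw [this, Complex.norm_real, Real.norm_of_nonneg (by positivity)]

theorem norm_recB (n : ℕ) : ‖(4 * (4 * n + 3) * (4 * n + 5) / ((n + 1) * (n + 2)) : ℂ)‖ =
    4 * (4 * n + 3) * (4 * n + 5) / ((n + 1) * (n + 2)) := by
  have : (4 * (4 * n + 3) * (4 * n + 5) / ((n + 1) * (n + 2)) : ℂ) =
      ((4 * (4 * n + 3) * (4 * n + 5) / ((n + 1) * (n + 2)) : ℝ) : ℂ) := by push_cast; rfl
  rw [this, Complex.norm_real, Real.norm_of_nonneg (by positivity)]

/-- The s² term of the recurrence is a small perturbation: the lower bound at n controls |`den s n`|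
by |`den s (n+1)`|. With the names of the proof, B/(A c) = 4 + 3/(4n²+8n+3) ≤ 5, so |s|² ≤ 10⁻⁴
keeps the relative error below 0.0006. -/
theorem den_norm_bounds {s : ℂ} (hs : ‖s‖ ≤ 1 / 100) (n : ℕ) :
    0.9994 * (2 * (2 * n + 1) / (n + 1)) * ‖den s n‖ ≤ ‖den s (n + 1)‖ ∧
      ‖den s (n + 1)‖ ≤ 1.0006 * (2 * (2 * n + 1) / (n + 1)) * ‖den s n‖ := by
  induction n with
  | zero => norm_num [den_zero, den_one]
  | succ n ih =>
    have hs2 := norm_sq_le hs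
    have hA := norm_recA n
    have hB := norm_recB n
    set A : ℝ := 2 * (2 * n + 3) / (n + 2) with hAdef
    set B : ℝ := 4 * (4 * n + 3) * (4 * n + 5) / ((n + 1) * (n + 2)) with hBdef
    set c : ℝ := 2 * (2 * n + 1) / (n + 1) with hcdef
    have hA0 : 0 < A := by positivity
    have hB0 : 0 < B := by positivity
    have hc0 : 0 < c := by positivity
    have hBAc : B * (1 / 10000) ≤ 0.0006 * A * (0.9994 * c) := by
      have h1 : B * (1 / 10000) = 4 * (4 * n + 3) * (4 * n + 5) * (1 / 10000) / ((n + 1) * (n + 2)) := by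
        rw [hBdef]; ring
      have h2 : 0.0006 * A * (0.9994 * c) =
          0.0006 * (2 * (2 * n + 3)) * (0.9994 * (2 * (2 * n + 1))) / ((n + 1) * (n + 2)) := by
        rw [hAdef, hcdef]; field_simp
      rw [h1, h2]
      gcongr ?_ / _
      have : (0 : ℝ) ≤ n := by positivity
      nlinarith
    have herr : B * ‖s‖ ^ 2 * ‖den s n‖ ≤ 0.0006 * A * ‖den s (n + 1)‖ := by
      calc B * ‖s‖ ^ 2 * ‖den s n‖ ≤ B * (1 / 10000) * ‖den s n‖ := by gcongr
        _ ≤ 0.0006 * A * (0.9994 * c) * ‖den s n‖ := by gcongr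
        _ = 0.0006 * A * (0.9994 * c * ‖den s n‖) := by ring
        _ ≤ _ := by gcongr; exact ih.1
    have hmain : ‖den s (n + 2) - (2 * (2 * n + 3) / (n + 2) : ℂ) * den s (n + 1)‖ ≤
        0.0006 * A * ‖den s (n + 1)‖ := by
      rw [den_add_two, add_sub_cancel_left, norm_mul, norm_mul, hB, norm_pow]
      exact herr
    have hn1 : ‖(2 * (2 * n + 3) / (n + 2) : ℂ) * den s (n + 1)‖ = A * ‖den s (n + 1)‖ := by
      rw [norm_mul, hA]
    have e : (2 * (2 * ((n + 1 : ℕ) : ℝ) + 1) / ((n + 1 : ℕ) + 1)) = A := by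
      rw [hAdef]; push_cast; ring
    rw [e]
    have h1 := norm_sub_norm_le ((2 * (2 * n + 3) / (n + 2) : ℂ) * den s (n + 1)) (den s (n + 2))
    have h2 := norm_sub_norm_le (den s (n + 2)) ((2 * (2 * n + 3) / (n + 2) : ℂ) * den s (n + 1))
    rw [norm_sub_rev] at h1
    constructor <;> linarith

theorem norm_den_le_succ {s : ℂ} (hs : ‖s‖ ≤ 1 / 100) (n : ℕ) : ‖den s n‖ ≤ ‖den s (n + 1)‖ := by
  refine le_trans ?_ (den_norm_bounds hs n).1
  have h : (2 : ℝ) ≤ 2 * (2 * n + 1) / (n + 1) := by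
    rw [le_div_iff₀ (by positivity)]; linarith [(Nat.cast_nonneg n : (0 : ℝ) ≤ n)]
  nlinarith [norm_nonneg (den s n)]

theorem norm_den_mono {s : ℂ} (hs : ‖s‖ ≤ 1 / 100) : Monotone fun n => ‖den s n‖ :=
  monotone_nat_of_le_succ (norm_den_le_succ hs)

theorem one_le_norm_den {s : ℂ} (hs : ‖s‖ ≤ 1 / 100) (n : ℕ) : 1 ≤ ‖den s n‖ := by
  have := norm_den_mono hs (Nat.zero_le n)
  simpa [den_zero] using this

theorem den_ne_zero {s : ℂ} (hs : ‖s‖ ≤ 1 / 100) (n : ℕ) : den s n ≠ 0 :=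
  norm_pos_iff.mp (by linarith [one_le_norm_den hs n])

theorem norm_den_le {s : ℂ} (hs : ‖s‖ ≤ 1 / 100) (n : ℕ) : ‖den s n‖ ≤ 4.0024 ^ n := by
  induction n with
  | zero => simp [den_zero]
  | succ n ih =>
    have h : (2 * (2 * n + 1) / (n + 1) : ℝ) ≤ 4 := by
      rw [div_le_iff₀ (by positivity)]; linarith
    calc _ ≤ _ := (den_norm_bounds hs n).2
      _ ≤ 1.0006 * 4 * 4.0024 ^ n := by gcongr
      _ = _ := by rw [pow_succ]; ring

/-- The Casoratian of numerators and denominators. -/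
noncomputable def casoratian (s : ℂ) (n : ℕ) : ℂ :=
  num s (n + 1) * den s n - num s n * den s (n + 1)

theorem casoratian_zero (s : ℂ) : casoratian s 0 = 2 * s := by
  simp [casoratian, num_zero, den_zero, num_one]

theorem casoratian_succ (s : ℂ) (n : ℕ) : casoratian s (n + 1) =
    -(4 * (4 * n + 3) * (4 * n + 5) / ((n + 1) * (n + 2)) * s ^ 2 * casoratian s n) := by
  simp only [casoratian]
  rw [show n + 1 + 1 = n + 2 by ring, num_add_two, den_add_two]
  ring

theorem casoratian_ne_zero {s : ℂ} (hs : s ≠ 0) (n : ℕ) : casoratian s n ≠ 0 := by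
  induction n with
  | zero => rw [casoratian_zero]; exact mul_ne_zero two_ne_zero hs
  | succ n ih =>
    rw [casoratian_succ]
    refine neg_ne_zero.mpr (mul_ne_zero (mul_ne_zero ?_ (pow_ne_zero 2 hs)) ih)
    rw [← norm_ne_zero_iff, norm_recB]
    positivity

/-- Each step multiplies the Casoratian by about 64|s|² and `den` by about 4. Keeping the factor
`den s (n + 1)` leaves the rate 16|s|² and cancels a denominator in the difference of approximants.
-/
theorem norm_casoratian_le {s : ℂ} (hs : ‖s‖ ≤ 1 / 100) (n : ℕ) :
    ‖casoratian s n‖ ≤ ‖s‖ * (16.01 * ‖s‖ ^ 2) ^ n * ‖den s (n + 1)‖ := by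
  induction n with
  | zero => rw [casoratian_zero, den_one, norm_mul]; simp [mul_comm]
  | succ n ih =>
    rw [casoratian_succ, norm_neg, norm_mul, norm_mul, norm_recB, norm_pow]
    have hd := (den_norm_bounds hs (n + 1)).1
    have hAB : (4 * (4 * n + 3) * (4 * n + 5) / ((n + 1) * (n + 2)) : ℝ) ≤
        16.01 * (0.9994 * (2 * (2 * (n + 1 : ℕ) + 1) / ((n + 1 : ℕ) + 1))) := by
      push_cast
      rw [mul_div_assoc', mul_div_assoc', div_le_div_iff₀ (by positivity) (by positivity)]
      have : (4 * (4 * n + 3) * (4 * n + 5) : ℝ) ≤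
          16.01 * (0.9994 * (2 * (2 * (n + 1) + 1))) * (n + 1) := by
        have : (0 : ℝ) ≤ n := by positivity
        nlinarith
      have h2 : (0 : ℝ) ≤ (n + 2) := by positivity
      nlinarith [mul_le_mul_of_nonneg_right this h2]
    calc _ ≤ 16.01 * (0.9994 * (2 * (2 * (n + 1 : ℕ) + 1) / ((n + 1 : ℕ) + 1))) * ‖s‖ ^ 2 *
          (‖s‖ * (16.01 * ‖s‖ ^ 2) ^ n * ‖den s (n + 1)‖) := by gcongr
      _ = ‖s‖ * (16.01 * ‖s‖ ^ 2) ^ (n + 1) *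
          (0.9994 * (2 * (2 * (n + 1 : ℕ) + 1) / ((n + 1 : ℕ) + 1)) * ‖den s (n + 1)‖) := by
          rw [pow_succ]; ring
      _ ≤ _ := by gcongr

/-- The Padé approximants of the small root. -/
noncomputable def approx (s : ℂ) (n : ℕ) : ℂ := -(num s n / den s n)

theorem approx_zero (s : ℂ) : approx s 0 = 0 := by simp [approx, num_zero]

theorem approx_succ_sub {s : ℂ} (hs : ‖s‖ ≤ 1 / 100) (n : ℕ) :
    approx s n - approx s (n + 1) = casoratian s n / (den s n * den s (n + 1)) := by
  have h1 := den_ne_zero hs n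
  have h2 := den_ne_zero hs (n + 1)
  simp only [approx, casoratian]
  field_simp
  ring

theorem dist_approx_succ_le {s : ℂ} (hs : ‖s‖ ≤ 1 / 100) (n : ℕ) :
    dist (approx s n) (approx s (n + 1)) ≤ ‖s‖ * (16.01 * ‖s‖ ^ 2) ^ n / ‖den s n‖ := by
  have h1 := one_le_norm_den hs n
  have h2 := one_le_norm_den hs (n + 1)
  rw [dist_eq_norm, approx_succ_sub hs, norm_div, norm_mul, div_le_div_iff₀ (by positivity) (by positivity)]
  have := mul_le_mul_of_nonneg_right (norm_casoratian_le hs n) (norm_nonneg (den s n))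
  linarith

theorem ratio_le {s : ℂ} (hs : ‖s‖ ≤ 1 / 100) : 16.01 * ‖s‖ ^ 2 ≤ 0.0017 := by
  linarith [norm_sq_le hs]

theorem dist_approx_add_le {s : ℂ} (hs : ‖s‖ ≤ 1 / 100) (n m : ℕ) :
    dist (approx s (n + m)) (approx s (n + (m + 1))) ≤
      ‖s‖ * (16.01 * ‖s‖ ^ 2) ^ n / ‖den s n‖ * (16.01 * ‖s‖ ^ 2) ^ m := by
  have h1 := one_le_norm_den hs n
  refine (dist_approx_succ_le hs (n + m)).trans ?_
  rw [pow_add, div_mul_eq_mul_div, mul_assoc ‖s‖]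
  gcongr
  exact norm_den_mono hs (Nat.le_add_right n m)

theorem norm_approx_le {s : ℂ} (hs : ‖s‖ ≤ 1 / 100) (n : ℕ) :
    ‖approx s n‖ ≤ 1.002 * ‖s‖ * (1 - 0.0017 ^ n) := by
  induction n with
  | zero => simp [approx_zero]
  | succ n ih =>
    have h := dist_approx_add_le hs 0 n
    simp only [zero_add, den_zero, pow_zero, norm_one, div_one, mul_one] at h
    have h2 : ‖s‖ * (16.01 * ‖s‖ ^ 2) ^ n ≤ ‖s‖ * 0.0017 ^ n := by
      gcongr; exact ratio_le hs
    have h3 : ‖approx s (n + 1)‖ ≤ ‖approx s n‖ + dist (approx s n) (approx s (n + 1)) := by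
      rw [dist_comm, dist_eq_norm]
      exact norm_le_norm_add_norm_sub' _ _
    have h4 : (0 : ℝ) ≤ ‖s‖ * 0.0017 ^ n := by positivity
    rw [pow_succ]
    nlinarith

theorem norm_approx_le' {s : ℂ} (hs : ‖s‖ ≤ 1 / 100) (n : ℕ) : ‖approx s n‖ ≤ 0.0101 := by
  have h := norm_approx_le hs n
  have h4 : (0 : ℝ) ≤ ‖s‖ * 0.0017 ^ n := by positivity
  nlinarith

theorem exists_tendsto_approx {s : ℂ} (hs : ‖s‖ ≤ 1 / 100) :
    ∃ L, Tendsto (approx s) atTop (𝓝 L) := by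
  refine cauchySeq_tendsto_of_complete (cauchySeq_of_le_geometric (16.01 * ‖s‖ ^ 2) ‖s‖
    (by linarith [ratio_le hs]) fun n => ?_)
  simpa [den_zero] using dist_approx_add_le hs 0 n

/-- The tail of the telescoping series is geometric, and its prefactor 1/|`den s n`| is cancelled on
multiplying by `den s n`. -/
theorem norm_den_mul_add_num_le {s L : ℂ} (hs : ‖s‖ ≤ 1 / 100)
    (hL : Tendsto (approx s) atTop (𝓝 L)) (n : ℕ) :
    ‖den s n * L + num s n‖ ≤ 1.002 * ‖s‖ * (16.01 * ‖s‖ ^ 2) ^ n := by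
  have hr := ratio_le hs
  have h1 := one_le_norm_den hs n
  have hlim : Tendsto (fun m => approx s (n + m)) atTop (𝓝 L) := by
    simpa [add_comm] using (tendsto_add_atTop_iff_nat n).mpr hL
  have h := dist_le_of_le_geometric_of_tendsto₀ (16.01 * ‖s‖ ^ 2)
    (‖s‖ * (16.01 * ‖s‖ ^ 2) ^ n / ‖den s n‖) (by linarith)
    (dist_approx_add_le hs n) hlim
  rw [add_zero, dist_comm, dist_eq_norm] at h
  have e : den s n * L + num s n = den s n * (L - approx s n) := by
    have := den_ne_zero hs n
    simp only [approx]
    field_simp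
    ring
  rw [e, norm_mul]
  calc ‖den s n‖ * ‖L - approx s n‖
      ≤ ‖den s n‖ * (‖s‖ * (16.01 * ‖s‖ ^ 2) ^ n / ‖den s n‖ / (1 - 16.01 * ‖s‖ ^ 2)) := by gcongr
    _ = ‖s‖ * (16.01 * ‖s‖ ^ 2) ^ n * (1 / (1 - 16.01 * ‖s‖ ^ 2)) := by field_simp
    _ ≤ ‖s‖ * (16.01 * ‖s‖ ^ 2) ^ n * 1.002 := by
      gcongr
      rw [div_le_iff₀ (by linarith)]
      linarith
    _ = _ := by ring

end SimpleQuartic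

/-! ### The limit is a root: Riccati equation and Gronwall. -/

namespace SimpleQuartic

theorem differentiable_recSeq {x₀ x₁ : ℂ → ℂ} (h₀ : Differentiable ℂ x₀) (h₁ : Differentiable ℂ x₁)
    (n : ℕ) : Differentiable ℂ fun s => recSeq (x₀ s) (x₁ s) s n := by
  induction n using Nat.twoStepInduction with
  | zero => exact h₀
  | one => exact h₁
  | more n h h' =>
    change Differentiable ℂ fun s => 2 * (2 * n + 3) / (n + 2) * recSeq (x₀ s) (x₁ s) s (n + 1) +
      4 * (4 * n + 3) * (4 * n + 5) / ((n + 1) * (n + 2)) * s ^ 2 * recSeq (x₀ s) (x₁ s) s n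
    fun_prop

theorem differentiable_den (n : ℕ) : Differentiable ℂ fun s => den s n :=
  differentiable_recSeq (differentiable_const _) (differentiable_const _) n

theorem differentiable_num (n : ℕ) : Differentiable ℂ fun s => num s n :=
  differentiable_recSeq (differentiable_const _) (differentiable_id.const_mul 2) n

theorem deriv_den_add_two (s : ℂ) (n : ℕ) : deriv (fun s => den s (n + 2)) s =
    2 * (2 * n + 3) / (n + 2) * deriv (fun s => den s (n + 1)) s +
      4 * (4 * n + 3) * (4 * n + 5) / ((n + 1) * (n + 2)) *
        (2 * s * den s n + s ^ 2 * deriv (fun s => den s n) s) := by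
  refine HasDerivAt.deriv ?_
  have h := (((differentiable_den (n + 1) s).hasDerivAt.const_mul (2 * (2 * n + 3) / (n + 2) : ℂ)).add
    ((((hasDerivAt_id s).pow 2).mul (differentiable_den n s).hasDerivAt).const_mul
      (4 * (4 * n + 3) * (4 * n + 5) / ((n + 1) * (n + 2)) : ℂ)))
  refine (h.congr_deriv ?_).congr_of_eventuallyEq (Eventually.of_forall fun s => ?_)
  · simp
  · simp [den_add_two]; ring

theorem deriv_num_add_two (s : ℂ) (n : ℕ) : deriv (fun s => num s (n + 2)) s =
    2 * (2 * n + 3) / (n + 2) * deriv (fun s => num s (n + 1)) s +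
      4 * (4 * n + 3) * (4 * n + 5) / ((n + 1) * (n + 2)) *
        (2 * s * num s n + s ^ 2 * deriv (fun s => num s n) s) := by
  refine HasDerivAt.deriv ?_
  have h := (((differentiable_num (n + 1) s).hasDerivAt.const_mul (2 * (2 * n + 3) / (n + 2) : ℂ)).add
    ((((hasDerivAt_id s).pow 2).mul (differentiable_num n s).hasDerivAt).const_mul
      (4 * (4 * n + 3) * (4 * n + 5) / ((n + 1) * (n + 2)) : ℂ)))
  refine (h.congr_deriv ?_).congr_of_eventuallyEq (Eventually.of_forall fun s => ?_)
  · simp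
  · simp [num_add_two]; ring

/-- Numerators and denominators satisfy a coupled first-order linear system in s. It is applied to
(x, w) = (`den`, -`num`) and (`num`, `den`), so one induction serves both. -/
theorem differential_step {s : ℂ} {x w d : ℕ → ℂ}
    (hx : ∀ n, x (n + 2) = 2 * (2 * n + 3) / (n + 2) * x (n + 1) +
      4 * (4 * n + 3) * (4 * n + 5) / ((n + 1) * (n + 2)) * s ^ 2 * x n)
    (hw : ∀ n, w (n + 2) = 2 * (2 * n + 3) / (n + 2) * w (n + 1) +
      4 * (4 * n + 3) * (4 * n + 5) / ((n + 1) * (n + 2)) * s ^ 2 * w n)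
    (hd : ∀ n, d (n + 2) = 2 * (2 * n + 3) / (n + 2) * d (n + 1) +
      4 * (4 * n + 3) * (4 * n + 5) / ((n + 1) * (n + 2)) * (2 * s * x n + s ^ 2 * d n))
    (h0 : (1 + 16 * s ^ 2) * d 1 = 16 * s * x 1 + w 1 - 30 * s * x 0)
    (h1 : (1 + 16 * s ^ 2) * d 2 = 32 * s * x 2 + w 2 - 63 * s * x 1) (n : ℕ) :
    (1 + 16 * s ^ 2) * d (n + 1) = 16 * (n + 1) * s * x (n + 1) + w (n + 1) -
      2 * (4 * n + 3) * (4 * n + 5) / (n + 1) * s * x n := by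
  induction n using Nat.twoStepInduction with
  | zero => simp only [zero_add, Nat.cast_zero]; rw [h0]; ring
  | one => norm_num; rw [h1]
  | more n ih ih' =>
    have n1 : (n : ℂ) + 1 ≠ 0 := by exact_mod_cast Nat.succ_ne_zero n
    have n2 : (n : ℂ) + 2 ≠ 0 := by exact_mod_cast Nat.succ_ne_zero (n + 1)
    have n3 : (n : ℂ) + 3 ≠ 0 := by exact_mod_cast Nat.succ_ne_zero (n + 2)
    have hx0 := hx n
    have hx1 := hx (n + 1)
    have hw1 := hw (n + 1)
    have hd1 := hd (n + 1)
    simp only [show n + 1 + 2 = n + 2 + 1 by ring, show n + 1 + 1 = n + 2 by ring] at *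
    push_cast at *
    have e1 : (n : ℂ) + 1 + 1 = n + 2 := by ring
    have e2 : (n : ℂ) + 1 + 2 = n + 3 := by ring
    have e3 : (n : ℂ) + 2 + 1 = n + 3 := by ring
    simp only [e1, e2, e3] at *
    rw [hd1, hx1, hw1]
    set b : ℂ := 4 * (4 * (n + 1) + 3) * (4 * (n + 1) + 5) / ((n + 2) * (n + 3)) with hb
    rw [show (4 * ((n : ℂ) + 2) + 3) = 4 * n + 11 by ring, show (4 * ((n : ℂ) + 2) + 5) = 4 * n + 13 by ring]
    linear_combination (norm := skip) 2 * (2 * ((n : ℂ) + 1) + 3) / (n + 3) * ih' + b * s ^ 2 * ih +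
      b * s * (n + 2) / 2 * hx0
    rw [hb]
    field_simp
    ring

theorem deriv_den (s : ℂ) (n : ℕ) :
    (1 + 16 * s ^ 2) * deriv (fun s => den s (n + 1)) s = 16 * (n + 1) * s * den s (n + 1) +
      -num s (n + 1) - 2 * (4 * n + 3) * (4 * n + 5) / (n + 1) * s * den s n := by
  refine differential_step (x := den s) (w := fun n => -num s n)
    (d := fun n => deriv (fun s => den s n) s) (den_add_two s) (fun n => ?_)
    (deriv_den_add_two s) ?_ ?_ n
  · simp only [num_add_two]; ring
  · simp [den_one, num_one, den_zero]; ring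
  · have h2 := deriv_den_add_two s 0
    have h3 := den_add_two s 0
    have h4 := num_add_two s 0
    simp only [zero_add, den_zero, den_one, num_zero, num_one] at h2 h3 h4 ⊢
    rw [h2, h3, h4]
    norm_num
    ring

theorem deriv_num (s : ℂ) (n : ℕ) :
    (1 + 16 * s ^ 2) * deriv (fun s => num s (n + 1)) s = 16 * (n + 1) * s * num s (n + 1) +
      den s (n + 1) - 2 * (4 * n + 3) * (4 * n + 5) / (n + 1) * s * num s n := by
  have h1 : deriv (fun s => num s 1) s = 2 := by
    simp only [num_one]
    simp
  refine differential_step (x := num s) (w := den s)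
    (d := fun n => deriv (fun s => num s n) s) (num_add_two s) (den_add_two s)
    (deriv_num_add_two s) ?_ ?_ n
  · rw [h1, den_one, num_one, num_zero]; ring
  · have h2 := deriv_num_add_two s 0
    have h3 := den_add_two s 0
    have h4 := num_add_two s 0
    simp only [zero_add, den_zero, den_one, num_zero, num_one] at h2 h3 h4 ⊢
    rw [h2, h3, h4]
    norm_num
    ring

/-- The quartic form `s * f_{1/s}`. -/
noncomputable def scaledQuartic (s y : ℂ) : ℂ := s * y ^ 4 - y ^ 3 - 6 * s * y ^ 2 + y + s

theorem one_add_ne_zero {s : ℂ} (hs : ‖s‖ ≤ 1 / 100) : 0.99 ≤ ‖1 + 16 * s ^ 2‖ := by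
  have h1 : ‖(16 * s ^ 2 : ℂ)‖ ≤ 0.0016 := by
    rw [norm_mul, norm_pow]
    have := norm_sq_le hs
    norm_num
    linarith
  have h2 := norm_sub_norm_le (1 : ℂ) (-(16 * s ^ 2))
  rw [norm_neg, norm_one, sub_neg_eq_add] at h2
  linarith

/-- The defect in the Riccati equation for the approximants. -/
noncomputable def riccatiDefect (s : ℂ) (n : ℕ) : ℂ :=
  2 * (4 * n + 3) * (4 * n + 5) / (n + 1) * s * casoratian s n /
    (den s (n + 1) ^ 2 * (1 + 16 * s ^ 2))

/-- In the quotient rule the coupling terms produce exactly 1 + y², and the terms of index n combine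
into the Casoratian, which is the defect. -/
theorem hasDerivAt_approx {s : ℂ} (hs : ‖s‖ ≤ 1 / 100) (n : ℕ) :
    HasDerivAt (fun s => approx s (n + 1))
      (-((1 + approx s (n + 1) ^ 2) / (1 + 16 * s ^ 2)) - riccatiDefect s n) s := by
  have hden := den_ne_zero hs (n + 1)
  have h1 : 1 + 16 * s ^ 2 ≠ 0 := norm_pos_iff.mp (by linarith [one_add_ne_zero hs])
  have hd := (((differentiable_num (n + 1) s).hasDerivAt).div
    ((differentiable_den (n + 1) s).hasDerivAt) hden).neg
  refine hd.congr_deriv ?_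
  have hu := deriv_den s n
  have hv := deriv_num s n
  have n1 : (n : ℂ) + 1 ≠ 0 := by exact_mod_cast Nat.succ_ne_zero n
  rw [approx, riccatiDefect, casoratian]
  set du := deriv (fun s => den s (n + 1)) s
  set dv := deriv (fun s => num s (n + 1)) s
  set k : ℂ := 2 * (4 * n + 3) * (4 * n + 5) / (n + 1)
  have hu' : du = (16 * (n + 1) * s * den s (n + 1) + -num s (n + 1) - k * s * den s n) /
      (1 + 16 * s ^ 2) := by rw [eq_div_iff h1, ← hu]; ring
  have hv' : dv = (16 * (n + 1) * s * num s (n + 1) + den s (n + 1) - k * s * num s n) /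
      (1 + 16 * s ^ 2) := by rw [eq_div_iff h1, ← hv]; ring
  rw [hu', hv']
  field_simp
  ring

/-- Along exact Riccati solutions the quartic satisfies a homogeneous linear equation; the defect
enters only as an inhomogeneous term. -/
theorem hasDerivAt_scaledQuartic {s : ℂ} (hs : ‖s‖ ≤ 1 / 100) (n : ℕ) :
    HasDerivAt (fun s => scaledQuartic s (approx s (n + 1)))
      (scaledQuartic s (approx s (n + 1)) * ((16 * s - 4 * approx s (n + 1)) / (1 + 16 * s ^ 2)) -
        (4 * s * approx s (n + 1) ^ 3 - 3 * approx s (n + 1) ^ 2 - 12 * s * approx s (n + 1) + 1) *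
          riccatiDefect s n) s := by
  have h1 : 1 + 16 * s ^ 2 ≠ 0 := norm_pos_iff.mp (by linarith [one_add_ne_zero hs])
  have hy := hasDerivAt_approx hs n
  have hi := hasDerivAt_id s
  have h := (((((hi.mul (hy.pow 4)).sub (hy.pow 3)).sub ((hi.const_mul 6).mul (hy.pow 2))).add hy).add hi)
  refine h.congr_deriv ?_
  simp only [scaledQuartic, id, Pi.pow_apply]
  push_cast
  generalize approx s (n + 1) = y
  generalize riccatiDefect s n = R
  have hw := mul_inv_cancel₀ h1
  simp only [div_eq_mul_inv]
  norm_num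
  linear_combination -(1 - 6 * y ^ 2 + y ^ 4) * hw

theorem norm_riccatiDefect_le {s : ℂ} (hs : ‖s‖ ≤ 1 / 100) (n : ℕ) :
    ‖riccatiDefect s n‖ ≤ (n + 1) * (1 / 2) ^ n := by
  have hc := norm_casoratian_le hs n
  have hd := one_le_norm_den hs (n + 1)
  have ho := one_add_ne_zero hs
  have hk : ‖(2 * (4 * n + 3) * (4 * n + 5) / (n + 1) : ℂ)‖ ≤ 32 * (n + 1) := by
    have : (2 * (4 * n + 3) * (4 * n + 5) / (n + 1) : ℂ) =
        ((2 * (4 * n + 3) * (4 * n + 5) / (n + 1) : ℝ) : ℂ) := by push_cast; rfl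
    rw [this, Complex.norm_real, Real.norm_of_nonneg (by positivity), div_le_iff₀ (by positivity)]
    nlinarith [(Nat.cast_nonneg n : (0 : ℝ) ≤ n)]
  rw [riccatiDefect, norm_div, norm_mul, norm_mul, norm_mul, norm_pow,
    div_le_iff₀ (by positivity)]
  have hr : (16.01 * ‖s‖ ^ 2) ^ n ≤ (1 / 2) ^ n := by
    gcongr; linarith [ratio_le hs]
  calc _ ≤ 32 * (n + 1) * ‖s‖ * (‖s‖ * (16.01 * ‖s‖ ^ 2) ^ n * ‖den s (n + 1)‖) := by gcongr
    _ ≤ 32 * (n + 1) * (1 / 100) * (1 / 100 * (1 / 2) ^ n * ‖den s (n + 1)‖) := by gcongr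
    _ = (n + 1) * (1 / 2) ^ n * (‖den s (n + 1)‖ * (32 / 10000)) := by ring
    _ ≤ (n + 1) * (1 / 2) ^ n * (‖den s (n + 1)‖ ^ 2 * ‖1 + 16 * s ^ 2‖) := by
      gcongr ?_ * ?_
      nlinarith

/-- Gronwall along the segment from 0 to s, starting from the value 0 at s = 0. -/
theorem norm_scaledQuartic_le {s : ℂ} (hs : ‖s‖ ≤ 1 / 100) (n : ℕ) :
    ‖scaledQuartic s (approx s (n + 1))‖ ≤ 4 * ((n + 1) * (1 / 2) ^ n) := by
  set ε : ℝ := (n + 1) * (1 / 2) ^ n with hε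
  have hε0 : 0 ≤ ε := by positivity
  have hsτ : ∀ τ ∈ Set.Icc (0 : ℝ) 1, ‖(τ : ℂ) * s‖ ≤ 1 / 100 := fun τ hτ => by
    rw [norm_mul, Complex.norm_real, Real.norm_of_nonneg hτ.1]
    nlinarith [norm_nonneg s, hτ.1, hτ.2]
  set g' : ℂ → ℂ := fun s => (scaledQuartic s (approx s (n + 1)) * ((16 * s - 4 * approx s (n + 1)) / (1 + 16 * s ^ 2)) -
        (4 * s * approx s (n + 1) ^ 3 - 3 * approx s (n + 1) ^ 2 - 12 * s * approx s (n + 1) + 1) *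
          riccatiDefect s n) with hg'
  have hder : ∀ τ ∈ Set.Icc (0 : ℝ) 1,
      HasDerivAt (fun τ : ℝ => scaledQuartic (τ * s) (approx (τ * s) (n + 1))) (g' (τ * s) * s) τ := by
    intro τ hτ
    have h1 := hasDerivAt_scaledQuartic (hsτ τ hτ) n
    have h2 : HasDerivAt (fun τ : ℝ => (τ : ℂ) * s) s τ := by
      simpa using (Complex.ofRealCLM.hasDerivAt (x := τ)).mul_const s
    exact h1.comp τ h2
  have hbound : ∀ τ ∈ Set.Ico (0 : ℝ) 1, ‖g' (τ * s) * s‖ ≤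
      1 * ‖scaledQuartic (τ * s) (approx (τ * s) (n + 1))‖ + 2 * ε := by
    intro τ hτ
    have hz := hsτ τ ⟨hτ.1, hτ.2.le⟩
    generalize (τ : ℂ) * s = z at hz ⊢
    have hy := norm_approx_le' hz (n + 1)
    have ho := one_add_ne_zero hz
    have hR := norm_riccatiDefect_le hz n
    rw [← hε] at hR
    simp only [hg']
    generalize approx z (n + 1) = y at *
    have hA : ‖(16 * z - 4 * y) / (1 + 16 * z ^ 2)‖ ≤ 1 := by
      rw [norm_div, div_le_one (by linarith)]
      have := norm_sub_le (16 * z) (4 * y)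
      simp only [norm_mul, Complex.norm_ofNat] at this
      linarith
    have hB : ‖4 * z * y ^ 3 - 3 * y ^ 2 - 12 * z * y + 1‖ ≤ 2 := by
      have hy2 : ‖y‖ ^ 2 ≤ 0.0101 ^ 2 := by gcongr
      have hy3 : ‖y‖ ^ 3 ≤ 0.0101 ^ 3 := by gcongr
      have h1 : ‖4 * z * y ^ 3‖ ≤ 4 * (1 / 100) * 0.0101 ^ 3 := by
        simp only [norm_mul, norm_pow, Complex.norm_ofNat]; gcongr
      have h2 : ‖3 * y ^ 2‖ ≤ 3 * 0.0101 ^ 2 := by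
        simp only [norm_mul, norm_pow, Complex.norm_ofNat]; gcongr
      have h3 : ‖12 * z * y‖ ≤ 12 * (1 / 100) * 0.0101 := by
        simp only [norm_mul, Complex.norm_ofNat]; gcongr
      have e1 := norm_add_le (4 * z * y ^ 3 - 3 * y ^ 2 - 12 * z * y) 1
      have e2 := norm_sub_le (4 * z * y ^ 3 - 3 * y ^ 2) (12 * z * y)
      have e3 := norm_sub_le (4 * z * y ^ 3) (3 * y ^ 2)
      rw [norm_one] at e1
      norm_num at *
      linarith
    rw [norm_mul]
    have hG : ‖scaledQuartic z y * ((16 * z - 4 * y) / (1 + 16 * z ^ 2)) -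
        (4 * z * y ^ 3 - 3 * y ^ 2 - 12 * z * y + 1) * riccatiDefect z n‖ ≤
        ‖scaledQuartic z y‖ * 1 + 2 * ε := by
      refine (norm_sub_le _ _).trans ?_
      rw [norm_mul, norm_mul]
      gcongr
    have := mul_le_mul_of_nonneg_left (hs.trans (by norm_num : (1 / 100 : ℝ) ≤ 1))
      (norm_nonneg (scaledQuartic z y * ((16 * z - 4 * y) / (1 + 16 * z ^ 2)) -
        (4 * z * y ^ 3 - 3 * y ^ 2 - 12 * z * y + 1) * riccatiDefect z n))
    linarith
  have hzero : ‖scaledQuartic ((0 : ℝ) * s) (approx ((0 : ℝ) * s) (n + 1))‖ ≤ 0 := by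
    have h := norm_approx_le (s := 0) (by simp) (n + 1)
    have h0 : approx 0 (n + 1) = 0 := by simpa using h
    simp [h0, scaledQuartic]
  -- The resulting bound is 2ε(e - 1), below 4ε.
  have h := norm_le_gronwallBound_of_norm_deriv_right_le (δ := 0) (K := 1) (ε := 2 * ε) (a := 0) (b := 1)
    (fun τ hτ => (hder τ hτ).continuousAt.continuousWithinAt)
    (fun τ hτ => (hder τ ⟨hτ.1, hτ.2.le⟩).hasDerivWithinAt) hzero hbound 1 (by simp)
  rw [gronwallBound_of_K_ne_0 one_ne_zero] at h
  have he := Real.exp_one_lt_d9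
  simp only [Complex.ofReal_one, one_mul] at h
  refine h.trans ?_
  norm_num
  nlinarith

theorem scaledQuartic_limit {s L : ℂ} (hs : ‖s‖ ≤ 1 / 100)
    (hL : Tendsto (approx s) atTop (𝓝 L)) : scaledQuartic s L = 0 := by
  have h1 : Tendsto (fun n => scaledQuartic s (approx s (n + 1))) atTop (𝓝 (scaledQuartic s L)) := by
    have hc : Continuous (scaledQuartic s) := by unfold scaledQuartic; fun_prop
    exact (hc.tendsto L).comp ((tendsto_add_atTop_iff_nat 1).mpr hL)
  refine tendsto_nhds_unique h1 (squeeze_zero_norm (norm_scaledQuartic_le hs) ?_)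
  have h2 : Tendsto (fun n : ℕ => (n : ℝ) * (1 / 2) ^ n) atTop (𝓝 0) :=
    tendsto_self_mul_const_pow_of_lt_one (by norm_num) (by norm_num)
  have h3 : Tendsto (fun n : ℕ => (1 / 2 : ℝ) ^ n) atTop (𝓝 0) :=
    tendsto_pow_atTop_nhds_zero_of_lt_one (by norm_num) (by norm_num)
  have := (h2.add h3).const_mul 4
  simpa [add_mul] using this

end SimpleQuartic

/-! ### Integrality of the numerators and denominators. -/

namespace SimpleQuartic

theorem pow_mul_den_add_num {t ε : ℂ} (ht : t ≠ 0) (hε : ε ^ 2 = -1) (n : ℕ) :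
    t ^ n * (den t⁻¹ n + ε * num t⁻¹ n) = ε ^ n * aeval (-ε * t - 4) (padePoly n) := by
  induction n using Nat.twoStepInduction with
  | zero =>
    have : padeCoeff 0 0 = 1 := by norm_num [padeCoeff, coeffAux]
    simp [padePoly, den_zero, num_zero, this]
  | one =>
    have h0 : padeCoeff 1 0 = 10 := by norm_num [padeCoeff, coeffAux]
    have h1 : padeCoeff 1 1 = 2 := by norm_num [padeCoeff, coeffAux]
    simp only [padePoly, Finset.sum_range_succ, Finset.sum_range_zero, h0, h1, den_one, num_one]
    simp
    field_simp
    linear_combination 2 * t * hε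
  | more n ih ih' =>
    have hrec := congrArg (aeval (-ε * t - 4)) (padePoly_recurrence n)
    simp only [map_mul, map_sub, map_add, aeval_C, aeval_X, eq_ratCast] at hrec
    push_cast at hrec
    have n1 : (n : ℂ) + 1 ≠ 0 := by exact_mod_cast Nat.succ_ne_zero n
    have n2 : (n : ℂ) + 2 ≠ 0 := by exact_mod_cast Nat.succ_ne_zero (n + 1)
    refine mul_left_cancel₀ (mul_ne_zero n1 n2) ?_
    set K0 := aeval (-ε * t - 4) (padePoly n)
    set K1 := aeval (-ε * t - 4) (padePoly (n + 1))
    set K2 := aeval (-ε * t - 4) (padePoly (n + 2))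
    have hl : ((n : ℂ) + 1) * (n + 2) * (t ^ (n + 2) * (den t⁻¹ (n + 2) + ε * num t⁻¹ (n + 2))) =
        (2 * n + 3) * (n + 1) * (2 * t) * (t ^ (n + 1) * (den t⁻¹ (n + 1) + ε * num t⁻¹ (n + 1))) +
          4 * (4 * n + 3) * (4 * n + 5) * (t ^ n * (den t⁻¹ n + ε * num t⁻¹ n)) := by
      rw [den_add_two, num_add_two, pow_succ, pow_succ]
      field_simp
      ring
    rw [hl, ih, ih']
    have e2 : ε ^ (n + 2) = ε ^ n * ε ^ 2 := pow_add _ _ _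
    rw [e2]
    linear_combination (-(ε ^ n * ε ^ 2)) * hrec +
      (4 * (4 * (n : ℂ) + 3) * (4 * n + 5) * ε ^ n * K0 +
        (2 * n + 3) * (n + 1) * 2 * t * ε * ε ^ n * K1) * hε

/-- The pairs `(P + iQ, P - iQ)` with `P` and `Q` in a given subring. -/
def conjPairs (S : Subring ℂ) : Subring (ℂ × ℂ) where
  carrier := {z | ∃ P ∈ S, ∃ Q ∈ S, z = (P + Complex.I * Q, P - Complex.I * Q)}
  zero_mem' := ⟨0, S.zero_mem, 0, S.zero_mem, by simp; rfl⟩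
  one_mem' := ⟨1, S.one_mem, 0, S.zero_mem, by simp; rfl⟩
  neg_mem' := by
    rintro _ ⟨P, hP, Q, hQ, rfl⟩
    exact ⟨-P, S.neg_mem hP, -Q, S.neg_mem hQ, by ext <;> simp <;> ring⟩
  add_mem' := by
    rintro _ _ ⟨P, hP, Q, hQ, rfl⟩ ⟨P', hP', Q', hQ', rfl⟩
    exact ⟨P + P', S.add_mem hP hP', Q + Q', S.add_mem hQ hQ', by ext <;> simp <;> ring⟩
  mul_mem' := by
    rintro _ _ ⟨P, hP, Q, hQ, rfl⟩ ⟨P', hP', Q', hQ', rfl⟩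
    refine ⟨P * P' - Q * Q', S.sub_mem (S.mul_mem hP hP') (S.mul_mem hQ hQ'), P * Q' + Q * P',
      S.add_mem (S.mul_mem hP hQ') (S.mul_mem hQ hP'), Prod.ext ?_ ?_⟩
    · change (P + Complex.I * Q) * (P' + Complex.I * Q') = _
      linear_combination Q * Q' * Complex.I_sq
    · change (P - Complex.I * Q) * (P' - Complex.I * Q') = _
      linear_combination Q * Q' * Complex.I_sq

/-- The number i need not lie in S. Evaluating at ε = i and ε = -i together inside `conjPairs S`
exhibits the values as P ± iQ with P, Q in S, so separating `den` from `num` costs no factor 2. -/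
theorem exists_mem_eq_commonFactor_mul (S : Subring ℂ) {t : ℂ} (ht : t ≠ 0) (htS : t ∈ S) (n : ℕ) :
    ∃ P ∈ S, ∃ Q ∈ S, t ^ n * den t⁻¹ n = (commonFactor n : ℂ) * P ∧
      t ^ n * num t⁻¹ n = (commonFactor n : ℂ) * Q := by
  choose e he using exists_int_padeCoeff n
  have hI : ((Complex.I, -Complex.I) : ℂ × ℂ) ∈ conjPairs S :=
    ⟨0, S.zero_mem, 1, S.one_mem, by simp⟩
  have hZ : ((-Complex.I * t - 4, Complex.I * t - 4) : ℂ × ℂ) ∈ conjPairs S := by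
    refine ⟨-4, S.neg_mem (ofNat_mem S 4), -t, S.neg_mem htS, ?_⟩
    ext <;> simp <;> ring
  have hmem := (conjPairs S).mul_mem ((conjPairs S).pow_mem hI n)
    ((conjPairs S).sum_mem (t := Finset.range (n + 1)) fun l _ =>
      (conjPairs S).mul_mem (intCast_mem (conjPairs S) (e l)) ((conjPairs S).pow_mem hZ l))
  obtain ⟨P, hP, Q, hQ, hPQ⟩ := hmem
  refine ⟨P, hP, Q, hQ, ?_⟩
  have h1 := congrArg Prod.fst hPQ
  have h2 := congrArg Prod.snd hPQ
  simp only [Prod.fst_mul, Prod.snd_mul, Prod.pow_fst, Prod.pow_snd, Prod.fst_sum, Prod.snd_sum,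
    Prod.fst_intCast, Prod.snd_intCast] at h1 h2
  have haeval : ∀ z : ℂ, aeval z (padePoly n) =
      (commonFactor n : ℂ) * ∑ l ∈ Finset.range (n + 1), (e l : ℂ) * z ^ l := fun z => by
    simp only [padePoly, map_sum, map_mul, aeval_C, map_pow, aeval_X, he, eq_ratCast, Finset.mul_sum]
    push_cast
    simp only [mul_assoc]
  have h3 := pow_mul_den_add_num ht Complex.I_sq n
  have h4 := pow_mul_den_add_num ht (ε := -Complex.I) (by simp) n
  rw [haeval] at h3 h4
  rw [neg_neg] at h4
  constructor
  · linear_combination (h3 + h4) / 2 + (commonFactor n : ℂ) / 2 * (h1 + h2)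
  · refine mul_left_cancel₀ Complex.I_ne_zero ?_
    linear_combination (h3 - h4) / 2 + (commonFactor n : ℂ) / 2 * (h1 - h2)

/-! ### The exponent κ and the irrationality criterion. -/

theorem log_hundred_gt : 4.6 < Real.log 100 := by
  have h2 := Real.log_two_gt_d9
  have h1 : Real.log 1.024 ≤ 0.024 := by
    have := Real.log_le_sub_one_of_pos (by norm_num : (0 : ℝ) < 1.024)
    norm_num at *; linarith
  -- This is 2²⁰ = 1.024² · 100³.
  have h3 : 3 * Real.log 100 = 20 * Real.log 2 - 2 * Real.log 1.024 := by
    rw [show (3 : ℝ) * Real.log 100 = Real.log (100 ^ 3) by rw [Real.log_pow]; norm_num,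
      show (20 : ℝ) * Real.log 2 = Real.log (2 ^ 20) by rw [Real.log_pow]; norm_num,
      show (2 : ℝ) * Real.log 1.024 = Real.log (1.024 ^ 2) by rw [Real.log_pow]; norm_num,
      ← Real.log_div (by norm_num) (by norm_num)]
    norm_num
  linarith

theorem log_gt_of_hundred_le {T : ℝ} (hT : 100 ≤ T) : 4.6 < Real.log T :=
  log_hundred_gt.trans_le (Real.log_le_log (by norm_num) hT)

theorem kappa_lt {t : ℂ} (ht : 100 ≤ ‖t‖) : kappa t < 2.83 := by
  have h := log_gt_of_hundred_le ht
  rw [kappa, div_lt_iff₀ (by linarith)]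
  norm_num at *
  linarith

theorem one_lt_kappa {t : ℂ} (ht : 100 ≤ ‖t‖) : 1 < kappa t := by
  have h := log_gt_of_hundred_le ht
  rw [kappa, one_lt_div (by linarith)]
  norm_num at *
  linarith

theorem growth_le_rpow_kappa {t : ℂ} (ht : 100 ≤ ‖t‖) :
    3.033 * ‖t‖ ≤ (‖t‖ / 12.14) ^ kappa t := by
  have h := log_gt_of_hundred_le ht
  have hk := one_lt_kappa ht
  have hT : 0 < ‖t‖ := by linarith
  have he := Real.exp_one_gt_d9
  have l1 : Real.log 3.033 ≤ 1.12 := by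
    rw [Real.log_le_iff_le_exp (by norm_num), show (1.12 : ℝ) = 1 + 0.12 by norm_num, Real.exp_add]
    have := Real.add_one_le_exp (0.12 : ℝ)
    nlinarith
  have l2 : Real.log 12.14 ≤ 2.5 := by
    rw [Real.log_le_iff_le_exp (by norm_num)]
    have h1 : Real.exp 2.5 ^ 2 = Real.exp 1 ^ 5 := by
      rw [← Real.exp_nat_mul, ← Real.exp_nat_mul]; norm_num
    have h2 : (2.7182818283 : ℝ) ^ 5 ≤ Real.exp 1 ^ 5 := by gcongr
    refine le_of_sq_le_sq ?_ (Real.exp_pos _).le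
    rw [h1]
    refine le_trans ?_ h2
    norm_num
  rw [← Real.log_le_log_iff (by positivity) (by positivity), Real.log_rpow (by positivity),
    Real.log_mul (by norm_num) (by positivity), Real.log_div (by positivity) (by norm_num)]
  set L := Real.log ‖t‖
  -- The constants 1.12 and 2.5 bound log 3.033 and log 12.14. After clearing the denominator of κ
  -- the L² terms cancel and a positive multiple of L remains.
  have h1 : L + 1.12 ≤ kappa t * (L - 2.5) := by
    rw [kappa, div_mul_eq_mul_div, le_div_iff₀ (by linarith)]
    norm_num at *
    nlinarith
  have h2 : kappa t * (L - 2.5) ≤ kappa t * (L - Real.log 12.14) := by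
    gcongr
  linarith

/-- Good approximations of moderate size give an effective irrationality measure. -/
theorem lt_norm_sub_div {S : Subring ℂ} (hS : ∀ x ∈ S, x ≠ 0 → 1 ≤ ‖x‖) {t β : ℂ}
    (ht : 100 ≤ ‖t‖) {p q : ℕ → ℂ} (hp : ∀ n, p n ∈ S) (hq : ∀ n, q n ∈ S)
    (hqn : ∀ n, ‖q n‖ ≤ 1.4 * (3.033 * ‖t‖) ^ n)
    (herr : ∀ n, ‖q n * β - p n‖ ≤ 2.8 / ‖t‖ * (12.14 / ‖t‖) ^ n)
    (hdet : ∀ n, p n * q (n + 1) ≠ p (n + 1) * q n) {x y : ℂ} (hx : x ∈ S) (hy : y ∈ S)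
    (hy0 : y ≠ 0) :
    1 / (15.48 * ‖t‖ * ‖y‖ ^ (kappa t + 1)) < ‖β - x / y‖ := by
  set T := ‖t‖ with hTdef
  set κ := kappa t with hκdef
  have hT : 0 < T := by linarith
  have hκ : 1 < κ := one_lt_kappa ht
  have hy1 : 1 ≤ ‖y‖ := hS y hy hy0
  have hr1 : 12.14 / T < 1 := by rw [div_lt_one hT]; linarith
  have hr0 : 0 ≤ 12.14 / T := by positivity
  have hex : ∃ m, ‖y‖ * (2.8 / T * (12.14 / T) ^ m) ≤ 1 / 2 := by
    have hlim : Tendsto (fun m : ℕ => ‖y‖ * (2.8 / T * (12.14 / T) ^ m)) atTop (𝓝 0) := by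
      have := ((tendsto_pow_atTop_nhds_zero_of_lt_one hr0 hr1).const_mul (2.8 / T)).const_mul ‖y‖
      simpa using this
    exact ((hlim.eventually_le_const (by norm_num : (0 : ℝ) < 1 / 2)).exists)
  classical
  -- Minimality of m bounds |y| from below, which later converts powers of 3.033 T into a power of
  -- |y|.
  set m := Nat.find hex with hm
  have hmspec := Nat.find_spec hex
  rw [← hm] at hmspec
  have hQ1 : 1 ≤ 3.033 * T := by linarith
  -- x/y cannot equal two consecutive approximants, since their determinant is nonzero; this costs
  -- at most one index.
  have hn : ∃ n, (n = m ∨ n = m + 1) ∧ q n * x - p n * y ≠ 0 := by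
    by_contra hcon
    push Not at hcon
    have h1 := hcon m (Or.inl rfl)
    have h2 := hcon (m + 1) (Or.inr rfl)
    refine hdet m (mul_left_cancel₀ hy0 ?_)
    linear_combination q m * h2 - q (m + 1) * h1
  obtain ⟨n, hnm, hne⟩ := hn
  have hle : ‖y‖ * ‖q n * β - p n‖ ≤ 1 / 2 := by
    refine le_trans ?_ hmspec
    gcongr
    refine (herr n).trans ?_
    gcongr ?_ * ?_
    exact pow_le_pow_of_le_one hr0 hr1.le (by omega)
  have hqle : ‖q n‖ ≤ 1.4 * (3.033 * T) ^ (m + 1) := by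
    refine (hqn n).trans ?_
    gcongr
    · omega
  have h1 : 1 ≤ ‖q n * x - p n * y‖ :=
    hS _ (S.sub_mem (S.mul_mem (hq n) hx) (S.mul_mem (hp n) hy)) hne
  have h2 : ‖q n * x - p n * y‖ ≤ ‖y‖ * ‖q n * β - p n‖ + ‖y‖ * (‖q n‖ * ‖β - x / y‖) := by
    have e : q n * x - p n * y = y * (q n * β - p n) - y * (q n * (β - x / y)) := by
      field_simp; ring
    rw [e]
    refine (norm_sub_le _ _).trans ?_
    simp only [norm_mul, le_refl]
  have h3 : 1 / 2 ≤ ‖y‖ * (1.4 * (3.033 * T) ^ (m + 1) * ‖β - x / y‖) := by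
    have : ‖y‖ * (‖q n‖ * ‖β - x / y‖) ≤ ‖y‖ * (1.4 * (3.033 * T) ^ (m + 1) * ‖β - x / y‖) := by
      gcongr
    linarith
  -- For m = 0, |y| ≥ 1 and 2.8 · 3.033 < 15.48 suffice. For m = k + 1, failure of the defining
  -- inequality at k gives |y| ≥ (T/12.14)^m, and `growth_le_rpow_kappa` applies.
  have hkey : 2.8 * (3.033 * T) ^ (m + 1) < 15.48 * T * ‖y‖ ^ κ := by
    rcases Nat.eq_zero_or_eq_succ_pred m with h0 | hk
    · rw [h0]
      have := Real.one_le_rpow hy1 (by linarith : 0 ≤ κ)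
      nlinarith
    · set k := m.pred
      have hmin := Nat.find_min hex (m := k) (by omega)
      rw [not_le] at hmin
      have hyk : T / 12.14 * (T / 12.14) ^ k ≤ ‖y‖ := by
        have e : T / 5.6 * (T / 12.14) ^ k * (2.8 / T * (12.14 / T) ^ k) = 1 / 2 := by
          rw [div_pow, div_pow]; field_simp; norm_num
        have hpos : 0 < 2.8 / T * (12.14 / T) ^ k := by positivity
        have : T / 5.6 * (T / 12.14) ^ k ≤ ‖y‖ := by
          rw [← e] at hmin
          exact (lt_of_mul_lt_mul_right hmin hpos.le).le
        refine le_trans ?_ this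
        gcongr
        norm_num
      have hg := growth_le_rpow_kappa ht
      have hpow : (3.033 * T) ^ (k + 1) ≤ ‖y‖ ^ κ := by
        calc (3.033 * T) ^ (k + 1) ≤ ((T / 12.14) ^ κ) ^ (k + 1) := by gcongr
          _ = (T / 12.14 * (T / 12.14) ^ k) ^ κ := by
            rw [← pow_succ', ← Real.rpow_natCast, ← Real.rpow_natCast, ← Real.rpow_mul (by positivity),
              ← Real.rpow_mul (by positivity), mul_comm]
          _ ≤ _ := by
            exact Real.rpow_le_rpow (by positivity) hyk (by linarith)
      rw [hk, Nat.succ_eq_add_one, pow_succ]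
      have hp0 : 0 < (3.033 * T) ^ (k + 1) := by positivity
      nlinarith [mul_le_mul_of_nonneg_left hpow hT.le, mul_pos hT hp0]
  have hδ : 0 < ‖β - x / y‖ := by
    by_contra hcon
    have : ‖β - x / y‖ = 0 := le_antisymm (not_lt.mp hcon) (norm_nonneg _)
    rw [this] at h3; norm_num at h3
  rw [div_lt_iff₀ (by positivity), Real.rpow_add (by positivity), Real.rpow_one]
  have hyδ : 0 < ‖y‖ * ‖β - x / y‖ := by positivity
  nlinarith [mul_lt_mul_of_pos_right hkey hyδ]

end SimpleQuartic

/-! ### The two roots and their approximations. -/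

namespace SimpleQuartic

theorem isRoot_quarticPoly_iff (t α : ℂ) : (quarticPoly t).IsRoot α ↔
    α ^ 4 - t * α ^ 3 - 6 * α ^ 2 + t * α + 1 = 0 := by
  simp [quarticPoly, IsRoot.def]

/-- Subtracting the two equations and dividing by α - β leaves t times a number of size at least
13/16 equal to a number of size about 3, impossible for |t| ≥ 100. -/
theorem isRoot_unique {t α β : ℂ} (ht : 100 ≤ ‖t‖) (hα : (quarticPoly t).IsRoot α)
    (hβ : (quarticPoly t).IsRoot β) (hα1 : ‖α‖ ≤ 1 / 4) (hβ1 : ‖β‖ ≤ 1 / 4) : α = β := by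
  rw [isRoot_quarticPoly_iff] at hα hβ
  by_contra hne
  have h : t * (1 - (α ^ 2 + α * β + β ^ 2)) =
      6 * (α + β) - (α ^ 3 + α ^ 2 * β + α * β ^ 2 + β ^ 3) := by
    refine mul_left_cancel₀ (sub_ne_zero.mpr hne) ?_
    linear_combination hα - hβ
  have h1 := congrArg norm h
  rw [norm_mul] at h1
  have hpow : ∀ i j : ℕ, ‖α ^ i * β ^ j‖ ≤ (1 / 4) ^ i * (1 / 4) ^ j := fun i j => by
    rw [norm_mul, norm_pow, norm_pow]; gcongr
  have a1 := hpow 2 0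
  have a2 := hpow 1 1
  have a3 := hpow 0 2
  have b1 := hpow 3 0
  have b2 := hpow 2 1
  have b3 := hpow 1 2
  have b4 := hpow 0 3
  simp only [pow_zero, mul_one, one_mul, pow_one] at a1 a2 a3 b1 b2 b3 b4
  have c1 := norm_add₃_le (a := α ^ 2) (b := α * β) (c := β ^ 2)
  have c2 := norm_sub_norm_le 1 (α ^ 2 + α * β + β ^ 2)
  have c3 := norm_sub_le (6 * (α + β)) (α ^ 3 + α ^ 2 * β + α * β ^ 2 + β ^ 3)
  have c4 := norm_add₄_le (a := α ^ 3) (b := α ^ 2 * β) (c := α * β ^ 2) (d := β ^ 3)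
  have c5 := norm_add_le α β
  rw [norm_mul, Complex.norm_ofNat] at c3
  rw [norm_one] at c2
  have d1 : 13 / 16 ≤ ‖1 - (α ^ 2 + α * β + β ^ 2)‖ := by linarith
  nlinarith [norm_nonneg t]

/-- With x = tan θ the map is θ ↦ θ + π/4, and f_t(x) = 0 depends only on tan 4θ. -/
theorem isRoot_conj {t α : ℂ} (h : (quarticPoly t).IsRoot α) (h1 : α ≠ 1) :
    (quarticPoly t).IsRoot (-((α + 1) / (α - 1))) := by
  rw [isRoot_quarticPoly_iff] at h ⊢
  have hne : α - 1 ≠ 0 := sub_ne_zero.mpr h1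
  field_simp
  linear_combination -4 * h

/-- The subring of `ℂ` formed by the integers of `ℚ(√(-d))`. -/
noncomputable def integerSubring (d : ℕ) : Subring ℂ :=
  ((ImagQuadField d).val.toRingHom.comp (algebraMap (𝓞 (ImagQuadField d)) (ImagQuadField d))).range

theorem toC_mem_integerSubring {d : ℕ} (x : 𝓞 (ImagQuadField d)) : toC x ∈ integerSubring d :=
  ⟨x, rfl⟩

theorem one_le_norm_of_mem_integerSubring {d : ℕ} (x : ℂ) (hx : x ∈ integerSubring d)
    (h0 : x ≠ 0) : 1 ≤ ‖x‖ := by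
  obtain ⟨y, rfl⟩ := hx
  exact one_le_norm_toC y h0

/-- Dividing by `commonFactor` turns the rates 4.0024 and 16.01 into 3.033 and 12.14, as 4.0024/1.32
< 3.033 and 16.01/1.32 < 12.14; the factors 4/3 and 1.34 come from the constant 3/4. -/
theorem exists_isRoot_approximations {S : Subring ℂ} {t : ℂ} (ht : 100 ≤ ‖t‖) (htS : t ∈ S) :
    ∃ α : ℂ, (quarticPoly t).IsRoot α ∧ ‖α‖ ≤ 0.0101 ∧
      ∃ P Q : ℕ → ℂ, (∀ n, P n ∈ S) ∧ (∀ n, Q n ∈ S) ∧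
        (∀ n, ‖P n‖ ≤ 4 / 3 * (3.033 * ‖t‖) ^ n) ∧ (∀ n, ‖Q n‖ ≤ 0.0101 * ‖P n‖) ∧
        (∀ n, ‖P n * α + Q n‖ ≤ 1.34 / ‖t‖ * (12.14 / ‖t‖) ^ n) ∧
        ∀ n, P n * Q (n + 1) - P (n + 1) * Q n ≠ 0 := by
  have hT : 0 < ‖t‖ := by linarith
  have ht0 : t ≠ 0 := norm_pos_iff.mp hT
  have hsn : ‖t⁻¹‖ = 1 / ‖t‖ := by rw [norm_inv, one_div]
  have hs : ‖t⁻¹‖ ≤ 1 / 100 := by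
    rw [hsn]; exact one_div_le_one_div_of_le (by norm_num) ht
  obtain ⟨α, hα⟩ := exists_tendsto_approx hs
  choose P hP Q hQ hden hnum using exists_mem_eq_commonFactor_mul S ht0 htS
  have hR0 : ∀ n, (commonFactor n : ℂ) ≠ 0 := fun n => by
    exact_mod_cast (commonFactor_pos n).ne'
  have hRn : ∀ n, 3 / 4 * 1.32 ^ n ≤ ‖(commonFactor n : ℂ)‖ := fun n => by
    have h := commonFactor_lower n
    have h' : ((3 / 4 * 1.32 ^ n : ℚ) : ℝ) ≤ (commonFactor n : ℝ) := by exact_mod_cast h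
    rw [Complex.norm_ratCast, abs_of_pos (by exact_mod_cast commonFactor_pos n)]
    refine le_trans (le_of_eq ?_) h'
    push_cast
    norm_num
  have hPn : ∀ n, ‖(commonFactor n : ℂ)‖ * ‖P n‖ = ‖t‖ ^ n * ‖den t⁻¹ n‖ := fun n => by
    rw [← norm_mul, ← hden, norm_mul, norm_pow]
  refine ⟨α, ?_, ?_, P, Q, hP, hQ, fun n => ?_, fun n => ?_, fun n => ?_, fun n => ?_⟩
  · have h := scaledQuartic_limit hs hα
    rw [isRoot_quarticPoly_iff]
    unfold scaledQuartic at h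
    have hti : t * t⁻¹ = 1 := mul_inv_cancel₀ ht0
    linear_combination t * h - (α ^ 4 - 6 * α ^ 2 + 1) * hti
  · exact le_of_tendsto hα.norm (Eventually.of_forall fun n => norm_approx_le' hs n)
  · have h1 : 3 / 4 * 1.32 ^ n * ‖P n‖ ≤ ‖t‖ ^ n * 4.0024 ^ n := by
      calc _ ≤ ‖(commonFactor n : ℂ)‖ * ‖P n‖ := by gcongr; exact hRn n
        _ = _ := hPn n
        _ ≤ _ := by gcongr; exact norm_den_le hs n
    have h2 : (4.0024 : ℝ) ^ n ≤ 1.32 ^ n * 3.033 ^ n := by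
      rw [← mul_pow]; gcongr; norm_num
    have h3 : 1.32 ^ n * (3 / 4 * ‖P n‖) ≤ 1.32 ^ n * (3.033 * ‖t‖) ^ n := by
      rw [mul_pow]
      nlinarith [mul_le_mul_of_nonneg_left h2 (pow_nonneg hT.le n)]
    have h4 := le_of_mul_le_mul_left h3 (by positivity)
    linarith
  · have h := norm_approx_le' hs n
    have hd := den_ne_zero hs n
    have e : Q n = -approx t⁻¹ n * P n := by
      refine mul_left_cancel₀ (hR0 n) ?_
      rw [← hnum, mul_left_comm, ← hden, approx]
      generalize den t⁻¹ n = D at hd ⊢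
      field_simp
    rw [e, norm_mul, norm_neg]
    gcongr
  · have e : (commonFactor n : ℂ) * (P n * α + Q n) = t ^ n * (den t⁻¹ n * α + num t⁻¹ n) := by
      linear_combination -α * hden n - hnum n
    have h := norm_den_mul_add_num_le hs hα n
    have h1 : 3 / 4 * 1.32 ^ n * ‖P n * α + Q n‖ ≤
        ‖t‖ ^ n * (1.002 * (1 / ‖t‖) * (16.01 * (1 / ‖t‖) ^ 2) ^ n) := by
      calc _ ≤ ‖(commonFactor n : ℂ)‖ * ‖P n * α + Q n‖ := by gcongr; exact hRn n
        _ = ‖t‖ ^ n * ‖den t⁻¹ n * α + num t⁻¹ n‖ := by rw [← norm_mul, e, norm_mul, norm_pow]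
        _ ≤ _ := by rw [← hsn]; gcongr
    have e2 : ‖t‖ ^ n * (1.002 * (1 / ‖t‖) * (16.01 * (1 / ‖t‖) ^ 2) ^ n) =
        1.002 / ‖t‖ * (16.01 / ‖t‖) ^ n := by
      rw [mul_left_comm, ← mul_pow]
      congr 1
      · ring
      · congr 1; field_simp
    have h2 : (16.01 / ‖t‖) ^ n ≤ 1.32 ^ n * (12.14 / ‖t‖) ^ n := by
      rw [← mul_pow, mul_div_assoc']; gcongr; norm_num
    rw [e2] at h1
    have h3 : 1.32 ^ n * (3 / 4 * ‖P n * α + Q n‖) ≤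
        1.32 ^ n * (1.002 / ‖t‖ * (12.14 / ‖t‖) ^ n) := by
      have := mul_le_mul_of_nonneg_left h2 (by positivity : 0 ≤ 1.002 / ‖t‖)
      linarith
    have h4 := le_of_mul_le_mul_left h3 (by positivity)
    have h5 : 1.002 / ‖t‖ * (12.14 / ‖t‖) ^ n * (4 / 3) ≤ 1.34 / ‖t‖ * (12.14 / ‖t‖) ^ n := by
      have : 1.002 / ‖t‖ * (4 / 3) ≤ 1.34 / ‖t‖ := by
        rw [div_mul_eq_mul_div]; gcongr; norm_num
      have h6 := mul_le_mul_of_nonneg_right this (by positivity : 0 ≤ (12.14 / ‖t‖) ^ n)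
      linarith
    linarith
  · have hc := casoratian_ne_zero (inv_ne_zero ht0) n
    intro h0
    have e : (commonFactor n : ℂ) * commonFactor (n + 1) * (P n * Q (n + 1) - P (n + 1) * Q n) =
        t ^ n * t ^ (n + 1) * casoratian t⁻¹ n := by
      rw [casoratian]
      linear_combination (-(commonFactor (n + 1) * Q (n + 1)) : ℂ) * hden n -
        t ^ n * den t⁻¹ n * hnum (n + 1) + (commonFactor n * Q n : ℂ) * hden (n + 1) +
        t ^ (n + 1) * den t⁻¹ (n + 1) * hnum n
    rw [h0, mul_zero] at e
    exact mul_ne_zero (mul_ne_zero (pow_ne_zero n ht0) (pow_ne_zero (n + 1) ht0)) hc e.symm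

end SimpleQuartic

theorem proposition2p2 (d : ℕ) (hd_pos : 0 < d) (hd : Squarefree d)
    (t : NumberField.RingOfIntegers (SimpleQuartic.ImagQuadField d))
    (ht : 100 ≤ ‖SimpleQuartic.toC t‖) :
    (∃! α : ℂ, (SimpleQuartic.quarticPoly (SimpleQuartic.toC t)).IsRoot α ∧ ‖α‖ ≤ 1 / 4) ∧
    (∀ α : ℂ, (SimpleQuartic.quarticPoly (SimpleQuartic.toC t)).IsRoot α → ‖α‖ ≤ 1 / 4 →
      (SimpleQuartic.quarticPoly (SimpleQuartic.toC t)).IsRoot (-((α + 1) / (α - 1))) ∧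
      ∀ p q : NumberField.RingOfIntegers (SimpleQuartic.ImagQuadField d),
        0.28 * ‖SimpleQuartic.toC t‖ ≤ ‖SimpleQuartic.toC q‖ →
          1 / (15.48 * ‖SimpleQuartic.toC t‖ *
              ‖SimpleQuartic.toC q‖ ^ (SimpleQuartic.kappa (SimpleQuartic.toC t) + 1)) <
            ‖α - SimpleQuartic.toC p / SimpleQuartic.toC q‖ ∧
          1 / (15.48 * ‖SimpleQuartic.toC t‖ *
              ‖SimpleQuartic.toC q‖ ^ (SimpleQuartic.kappa (SimpleQuartic.toC t) + 1)) <
            ‖-((α + 1) / (α - 1)) - SimpleQuartic.toC p / SimpleQuartic.toC q‖) ∧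
    SimpleQuartic.kappa (SimpleQuartic.toC t) < 2.83 := by
  open SimpleQuartic in
  have htS := toC_mem_integerSubring t
  obtain ⟨α₀, hroot, hsmall, P, Q, hP, hQ, hPn, hQn, herr, hdet⟩ :=
    exists_isRoot_approximations ht htS
  have hα₀ : ‖α₀‖ ≤ 1 / 4 := hsmall.trans (by norm_num)
  refine ⟨⟨α₀, ⟨hroot, hα₀⟩, fun β hβ => isRoot_unique ht hβ.1 hroot hβ.2 hα₀⟩,
    fun α hα hα1 => ?_, kappa_lt ht⟩
  obtain rfl : α = α₀ := isRoot_unique ht hα hroot hα1 hα₀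
  have hne : α ≠ 1 := by
    rintro rfl
    norm_num at hα1
  have hsub : 0.98 ≤ ‖1 - α‖ := by
    have := norm_sub_norm_le 1 α
    rw [norm_one] at this
    linarith
  have hT : 0 < ‖toC t‖ := by linarith
  refine ⟨isRoot_conj hα hne, fun p q hq => ?_⟩
  have hq0 : toC q ≠ 0 := by
    rw [← norm_pos_iff]
    linarith
  -- The approximations are -Q/P for α, and its image (P - Q)/(P + Q) under x ↦ (1 + x)/(1 - x) for
  -- the other root; the determinant is doubled, so still nonzero.
  refine ⟨lt_norm_sub_div one_le_norm_of_mem_integerSubring ht (p := fun n => -Q n) (q := P)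
    (fun n => neg_mem (hQ n)) hP (fun n => ?_) (fun n => ?_) (fun n h => hdet n ?_)
    (toC_mem_integerSubring p) (toC_mem_integerSubring q) hq0,
    lt_norm_sub_div one_le_norm_of_mem_integerSubring ht (p := fun n => P n - Q n)
    (q := fun n => P n + Q n) (fun n => sub_mem (hP n) (hQ n)) (fun n => add_mem (hP n) (hQ n))
    (fun n => ?_) (fun n => ?_) (fun n h => hdet n ?_)
    (toC_mem_integerSubring p) (toC_mem_integerSubring q) hq0⟩
  · refine (hPn n).trans ?_
    gcongr
    norm_num
  · rw [sub_neg_eq_add]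
    refine (herr n).trans ?_
    gcongr
    norm_num
  · linear_combination h
  · have h1 := norm_add_le (P n) (Q n)
    have h2 := hPn n
    have h3 := hQn n
    have h4 : 0 ≤ (3.033 * ‖toC t‖) ^ n := by positivity
    linarith
  -- The Möbius map costs the factor 2/|1 - α|, and 2 · 1.34/0.98 < 2.8.
  · have e : (P n + Q n) * -((α + 1) / (α - 1)) - (P n - Q n) = 2 * (P n * α + Q n) / (1 - α) := by
      have h1 : α - 1 ≠ 0 := sub_ne_zero.mpr hne
      have h2 : 1 - α ≠ 0 := sub_ne_zero.mpr hne.symm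
      field_simp
      ring
    have h1 := herr n
    have h2 : 0 ≤ 1 / ‖toC t‖ * (12.14 / ‖toC t‖) ^ n := by positivity
    rw [e, norm_div, norm_mul, Complex.norm_ofNat, div_le_iff₀ (by linarith)]
    have h3 : 2.8 / ‖toC t‖ * (12.14 / ‖toC t‖) ^ n * 0.98 ≤
        2.8 / ‖toC t‖ * (12.14 / ‖toC t‖) ^ n * ‖1 - α‖ := by gcongr
    refine le_trans ?_ h3
    have e1 : 1.34 / ‖toC t‖ * (12.14 / ‖toC t‖) ^ n =
      1.34 * (1 / ‖toC t‖ * (12.14 / ‖toC t‖) ^ n) := by ring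
    have e2 : 2.8 / ‖toC t‖ * (12.14 / ‖toC t‖) ^ n * 0.98 =
      2.8 * 0.98 * (1 / ‖toC t‖ * (12.14 / ‖toC t‖) ^ n) := by ring
    rw [e2]
    rw [e1] at h1
    linarith
  · linear_combination h / 2
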